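/- **Theorem 6.14.** Let $m=1$ (Haar case), let $\tilde m\in\mathbb N$ be odd and let $p\in\mathbb N_0$. All functions are complex-valued, $\overline{\,\cdot\,}$ applied to a set of functions is the closure in $L_2(\mathbb R)$, $(\mathcal Ff)(\xi)=(2\pi)^{-1/2}\int_{\mathbb R}f(x)e^{-ix\xi}\,dx$ (extended unitarily to $L_2(\mathbb R)$), and $[f,g](\xi)=\sum_{k\in\mathbb Z}f(\xi+2\pi k)\overline{g(\xi+2\pi k)}$. For $q\in\mathbb N_0$ let $\varphi_q(x)=x^q\chi_{[0,1)}(x)$ be the Haar quarks and $\psi_q=\sum_{k\in\mathbb Z}b_k\,\varphi_q(2\,\cdot-k)$ the quarklets, where $b_k=(-1)^k\tilde a_{1-k}$ are the coefficients of the Cohen–Daubechies–Feauveau wavelet $\psi_0$ for $(m,\tilde m)=(1,\tilde m)$. Here the $\tilde a_k\in\mathbb R$, finitely many of them nonzero, are given with $z=e^{-i\xi}$ and $r=(\tilde m-1)/2$ by $$\frac12\sum_{k\in\mathbb Z}\tilde a_kz^k=\frac{1+z}{2}\,\Big(\cos^2\frac{\xi}{2}\Big)^{r}\sum_{n=0}^{r}\binom{r+n}{n}\Big(\sin^2\frac{\xi}{2}\Big)^{n}.$$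 Define the orthogonalized quarklets $\psi_q^\star$ by $\psi_0^\star=\psi_0$ and, recursively for $q\ge1$ (with the convention $\frac00=0$), $$\mathcal F\psi_q^\star=\mathcal F\psi_q-\sum_{l=0}^{q-1}\frac{[\mathcal F\psi_q,\mathcal F\psi_l^\star]}{[\mathcal F\psi_l^\star,\mathcal F\psi_l^\star]}\,\mathcal F\psi_l^\star .$$ For $j\in\mathbb Z$ put $$V_{p,j}=\overline{\operatorname{span}\{2^{j/2}\varphi_q(2^j\cdot-k):0\le q\le p,\ k\in\mathbb Z\}},\qquad W_{p,j}=\overline{\operatorname{span}\{2^{j/2}\psi_q(2^j\cdot-k):0\le q\le p,\ k\in\mathbb Z\}},$$ $$W_{p,j}^\star=\overline{\operatorname{span}\{2^{j/2}\psi_q^\star(2^j\cdot-k):0\le q\le p,\ k\in\mathbb Z\}},\qquad W_{q,j}^{\star\star}=\overline{\operatorname{span}\{2^{j/2}\psi_q^\star(2^j\cdot-k):k\in\mathbb Z\}}.$$ Then $\psi_0^\star,\dots,\psi_p^\star$ are well-defined elements of $L_2(\mathbb R)$, for every $j\in\mathbb Z$ $$W_{p,j}^\star=\hat{\bigoplus}_{q=0}^{p}W_{q,j}^{\star\star}=W_{p,j},$$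 and $$L_2(\mathbb R)=\overline{\bigoplus_{j\in\mathbb Z}W_{p,j}^\star}=\overline{\bigoplus_{j\in\mathbb Z}\hat{\bigoplus}_{q=0}^{p}W_{q,j}^{\star\star}},\qquad L_2(\mathbb R)=\overline{V_{p,0}\oplus\bigoplus_{j=0}^{\infty}W_{p,j}^\star}=\overline{V_{p,0}\oplus\bigoplus_{j=0}^{\infty}\hat{\bigoplus}_{q=0}^{p}W_{q,j}^{\star\star}} .$$ Here $\oplus$ denotes the (in general non-orthogonal) algebraic direct sum, whose directness is part of the claim, and $\hat\oplus$ denotes the orthogonal direct sum. -/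

import Mathlib

open MeasureTheory

namespace Quarklet

noncomputable section

/-- The Hilbert space `L₂(ℝ)` of complex-valued functions. -/
abbrev L2R : Type := Lp ℂ 2 (volume : Measure ℝ)

/-- The Haar quark `φ_q(x) = x^q N₁(x)`, where `N₁ = χ_[0,1)` is the B-spline of order `m = 1`
(here `⌈m/2⌉ = 1` and `⌊m/2⌋ = 0`). -/
def quark (q : ℕ) (x : ℝ) : ℂ :=
  (x : ℂ) ^ q * Set.indicator (Set.Ico (0 : ℝ) 1) (fun _ => (1 : ℂ)) x

/-- The Laurent polynomial `cos²(ξ/2) = (2 + z + z⁻¹)/4`, `z = e^{-iξ}`. -/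
def cosSq : LaurentPolynomial ℝ :=
  LaurentPolynomial.C (1 / 4) * (2 + LaurentPolynomial.T 1 + LaurentPolynomial.T (-1))

/-- The Laurent polynomial `sin²(ξ/2) = (2 - z - z⁻¹)/4`, `z = e^{-iξ}`. -/
def sinSq : LaurentPolynomial ℝ :=
  LaurentPolynomial.C (1 / 4) * (2 - LaurentPolynomial.T 1 - LaurentPolynomial.T (-1))

/-- The Cohen-Daubechies-Feauveau dual mask `ã(z) = ∑ ã_k z^k` for `m = 1` and odd `m̃ = 2 r + 1`:
`½ ã(z) = ½ (1 + z) cos(ξ/2)^(2r) ∑_{n=0}^{r} binom(r+n, n) sin(ξ/2)^(2n)`, `z = e^{-iξ}`. -/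
def dualMask (mt : ℕ) : LaurentPolynomial ℝ :=
  (1 + LaurentPolynomial.T 1) * cosSq ^ ((mt - 1) / 2) *
    ∑ n ∈ Finset.range ((mt - 1) / 2 + 1),
      LaurentPolynomial.C ((((mt - 1) / 2 + n).choose n : ℕ) : ℝ) * sinSq ^ n

/-- The coefficients `b_k = (-1)^k ã_{1-k}` of the CDF wavelet `ψ = ∑ b_k φ(2 · - k)`. -/
def waveletCoeff (mt : ℕ) (k : ℤ) : ℝ :=
  (-1 : ℝ) ^ k * (dualMask mt).coeff (1 - k)

/-- The Haar quarklet `ψ_q = ∑_k b_k φ_q(2 · - k)`. The sum is finite. -/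
def quarklet (mt q : ℕ) (x : ℝ) : ℂ :=
  ∑ᶠ k : ℤ, (waveletCoeff mt k : ℂ) * quark q (2 * x - k)

/-- The Fourier transform `(2π)^{-1/2} ∫ f(x) e^{-ixξ} dx` of an integrable function. -/
def fourier (f : ℝ → ℂ) (ξ : ℝ) : ℂ :=
  ((1 / Real.sqrt (2 * Real.pi) : ℝ) : ℂ) *
    ∫ x : ℝ, f x * Complex.exp (-(Complex.I * (x : ℂ) * (ξ : ℂ)))

/-- The bracket `[f, g](ξ) = ∑_{k ∈ ℤ} f(ξ + 2πk) conj(g(ξ + 2πk))`. -/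
def bracket (f g : ℝ → ℂ) (ξ : ℝ) : ℂ :=
  ∑' k : ℤ, f (ξ + 2 * Real.pi * k) * (starRingEnd ℂ) (g (ξ + 2 * Real.pi * k))

/-- The Fourier transforms of the orthogonalized quarklets,
`ψ_q^* ^ = ψ_q ^ - ∑_{l < q} [ψ_q ^, ψ_l^* ^] / [ψ_l^* ^, ψ_l^* ^] ψ_l^* ^`, with `0 / 0 = 0`. -/
def starHat (mt : ℕ) : ℕ → ℝ → ℂ
  | q => fun ξ =>
      fourier (quarklet mt q) ξ -
        ∑ l : Fin q,
          bracket (fourier (quarklet mt q)) (starHat mt l) ξ /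
            bracket (starHat mt l) (starHat mt l) ξ * starHat mt l ξ
  termination_by q => q
  decreasing_by all_goals exact l.isLt

/-- The function `η ↦ √(2π) g(2πη)`. It is the Fourier transform `∫ f(x) e^{-2πixη} dx` in
Mathlib's normalization when `g` is the Fourier transform `(2π)^{-1/2} ∫ f(x) e^{-ixξ} dx`. -/
def rescale (g : ℝ → ℂ) (η : ℝ) : ℂ :=
  ((Real.sqrt (2 * Real.pi) : ℝ) : ℂ) * g (2 * Real.pi * η)

open Classical in
/-- The inverse Fourier transform of `g` in `L₂(ℝ)` for the normalization
`(2π)^{-1/2} ∫ f(x) e^{-ixξ} dx` (and `0` if `g` is not square integrable). -/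
def invFourier (g : ℝ → ℂ) : L2R :=
  if h : MemLp (rescale g) 2 (volume : Measure ℝ) then
    (Lp.fourierTransformₗᵢ ℝ ℂ).symm (h.toLp (rescale g))
  else 0

/-- The orthogonalized quarklet `ψ_q^*`. -/
def starQuarklet (mt q : ℕ) : L2R := invFourier (starHat mt q)

/-- The closed linear span in `L₂(ℝ)` of the functions `2^{j/2} f_q(2^j · - k)`, with `q ∈ s` and
`k ∈ ℤ`. -/
def shiftSpace (f : ℕ → ℝ → ℂ) (s : Set ℕ) (j : ℤ) : Submodule ℂ L2R :=
  (Submodule.span ℂ {g : L2R | ∃ q ∈ s, ∃ k : ℤ, (g : ℝ → ℂ) =ᵐ[volume]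
    fun x : ℝ => (((2 : ℝ) ^ ((j : ℝ) / 2) : ℝ) : ℂ) *
      f q ((2 : ℝ) ^ j * x - k)}).topologicalClosure

/-- `V_{p,j}`. -/
def spaceV (p : ℕ) (j : ℤ) : Submodule ℂ L2R := shiftSpace quark (Set.Iic p) j

/-- `W_{p,j}`. -/
def spaceW (mt p : ℕ) (j : ℤ) : Submodule ℂ L2R := shiftSpace (quarklet mt) (Set.Iic p) j

/-- `W^*_{p,j}`. -/
def spaceWStar (mt p : ℕ) (j : ℤ) : Submodule ℂ L2R :=
  shiftSpace (fun q => (starQuarklet mt q : ℝ → ℂ)) (Set.Iic p) j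

/-- `W^{**}_{q,j}`. -/
def spaceWStarStar (mt q : ℕ) (j : ℤ) : Submodule ℂ L2R :=
  shiftSpace (fun r => (starQuarklet mt r : ℝ → ℂ)) {q} j

/-- The algebraic sum of the subspaces `U i` is direct and `L₂(ℝ)` is its closure. -/
def IsClosureOfDirectSum {ι : Type} (U : ι → Submodule ℂ L2R) : Prop :=
  iSupIndep U ∧ (⨆ i, U i).topologicalClosure = ⊤

/-- The family `V, U 0, U 1, U 2, …`. -/
def consFamily (V : Submodule ℂ L2R) (U : ℕ → Submodule ℂ L2R) : Option ℕ → Submodule ℂ L2R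
  | none => V
  | some j => U j

end

end Quarklet

/-! The theorem splits into three questions: orthogonalization, directness and density.

Orthogonalization. After rescaling, the bracket of two Fourier transforms is the `ℓ²(ℤ)` inner
product of their restrictions to the fibres `η + ℤ`. Hence the recursion for `starHat` is
Gram-Schmidt on almost every fibre (`rescale_starHat_eq_gramSchmidt`), which does not increase
norms, produces orthogonal vectors and preserves spans. Since `g` is orthogonal to all integer
translates of `ψ` iff the bracket of their transforms vanishes a.e.
(`forall_inner_translate_eq_zero_iff`), these three facts give square integrability, `W^{**}_q ⟂
W^{**}_r`, and equality of the orthogonal complements of `W^*` and `W`.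

Directness. For `f` in `V_{p,j} ∩ W_{p,j}`, compare quark coefficients at level `j + 1`. The dual
filter annihilates those of `W`; on those of `V` it returns the coefficient of degree `q`, provided
all higher ones vanish, because refinement is triangular in the degree. Descending induction gives
`disjoint_spaceV_spaceW`, and the filtration `V_{p,j}` turns this into independence of all
`W_{p,j}`.

Density. The wavelets of degree 0 suffice. If `f` is orthogonal to all of them, its primitive `F`
satisfies on every dyadic grid the Deslauriers-Dubuc rule: odd samples are interpolated from even
ones (`primitive_relation`). Iterating, `F` at a grid point is a combination of values on the `2^J`
times coarser grid, with boundedly many terms. Off the origin the coefficients are `O(2^{-J/2})`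
(`abs_subdivKernel_le`), because the symbol is nonnegative, interpolatory and concentrates at
frequency 0. Since `F 0 = 0` and `F y = o(√|y|)`, letting `J → ∞` gives `F = 0`
(`eq_zero_of_subdivision`). -/

namespace Quarklet

/-! ### Daubechies' Bezout polynomial -/

section Bezout

variable {R : Type*} [CommRing R]

/-- Daubechies' Bezout polynomial `c^(r+1) ∑_{n ≤ r} binom(r+n, n) s^n`. -/
def bezoutSum (r : ℕ) (c s : R) : R :=
  c ^ (r + 1) * ∑ n ∈ Finset.range (r + 1), ((r + n).choose n : R) * s ^ n

/-- Pascal's rule expresses the sum for `r + 1` through itself times `s` plus the sum for `r`. The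
boundary terms merge by `binom(2r+2, r+1) = 2 binom(2r+1, r+1)`, whence the factor `1 - 2s`. -/
theorem mul_sum_choose_succ (r : ℕ) {c s : R} (h : c + s = 1) :
    c * ∑ n ∈ Finset.range (r + 2), ((r + 1 + n).choose n : R) * s ^ n =
      ∑ n ∈ Finset.range (r + 1), ((r + n).choose n : R) * s ^ n +
        ((2 * r + 1).choose (r + 1) : R) * s ^ (r + 1) * (1 - 2 * s) := by
  have hc : c = 1 - s := by rw [← h]; ring
  have hchoose : (((r + 1 + (r + 1)).choose (r + 1) : ℕ) : R) =
      2 * ((2 * r + 1).choose (r + 1) : R) := by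
    have h2 : (r + 1 + (r + 1)).choose (r + 1) = 2 * (2 * r + 1).choose (r + 1) := by
      have e : r + 1 + (r + 1) = 2 * r + 1 + 1 := by ring
      rw [e, Nat.choose_succ_succ', Nat.choose_symm_half]
      ring
    rw [h2]; push_cast; ring
  have hs : ∑ n ∈ Finset.range (r + 2), ((r + 1 + n).choose n : R) * s ^ n =
      s * (∑ n ∈ Finset.range (r + 1), ((r + 1 + n).choose n : R) * s ^ n) +
        ∑ n ∈ Finset.range (r + 2), ((r + n).choose n : R) * s ^ n := by
    rw [Finset.sum_range_succ' _ (r + 1), Finset.sum_range_succ' (fun n => ((r + n).choose n : R) * s ^ n)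
      (r + 1), Finset.mul_sum, ← add_assoc, ← Finset.sum_add_distrib]
    congr 1
    · refine Finset.sum_congr rfl fun n _ => ?_
      rw [show r + 1 + (n + 1) = r + 1 + n + 1 by ring, Nat.choose_succ_succ',
        show r + (n + 1) = r + 1 + n by ring]
      push_cast
      ring
    · simp
  have h1 := Finset.sum_range_succ (fun n => ((r + 1 + n).choose n : R) * s ^ n) (r + 1)
  have h3 := Finset.sum_range_succ (fun n => ((r + n).choose n : R) * s ^ n) (r + 1)
  rw [show r + (r + 1) = 2 * r + 1 by ring] at h3
  rw [hchoose] at h1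
  rw [h3] at hs
  rw [hc, sub_mul, one_mul]
  nth_rewrite 1 [hs]
  rw [h1]
  ring

/-- The increment is antisymmetric in `c, s`, so it cancels in `bezoutSum_add_swap`; it is
nonnegative for `0 ≤ s ≤ c`, so the polynomial increases with `r` in `le_bezoutSum`. -/
theorem bezoutSum_succ (r : ℕ) {c s : R} (h : c + s = 1) :
    bezoutSum (r + 1) c s =
      bezoutSum r c s + ((2 * r + 1).choose (r + 1) : R) * (c * s) ^ (r + 1) * (c - s) := by
  unfold bezoutSum
  rw [pow_succ c (r + 1), mul_assoc, mul_sum_choose_succ r h, mul_pow]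
  have hc : c = 1 - s := by rw [← h]; ring
  have : c - s = 1 - 2 * s := by rw [hc]; ring
  rw [this]
  ring

theorem bezoutSum_add_swap (r : ℕ) {c s : R} (h : c + s = 1) :
    bezoutSum r c s + bezoutSum r s c = 1 := by
  induction r with
  | zero => simpa [bezoutSum] using h
  | succ r ih =>
    rw [bezoutSum_succ r h, bezoutSum_succ r (by rw [add_comm]; exact h), mul_comm s c]
    linear_combination ih

theorem le_bezoutSum (r : ℕ) {c s : ℝ} (h : c + s = 1) (hs : 0 ≤ s) (hc : s ≤ c) :
    c ≤ bezoutSum r c s := by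
  induction r with
  | zero => simp [bezoutSum]
  | succ r ih =>
    rw [bezoutSum_succ r h]
    have : 0 ≤ ((2 * r + 1).choose (r + 1) : ℝ) * (c * s) ^ (r + 1) * (c - s) := by
      have : 0 ≤ c * s := mul_nonneg (hs.trans hc) hs
      have : 0 ≤ c - s := sub_nonneg.2 hc
      positivity
    linarith

theorem bezoutSum_nonneg (r : ℕ) {c s : ℝ} (hs : 0 ≤ s) (hc : 0 ≤ c) : 0 ≤ bezoutSum r c s := by
  unfold bezoutSum
  positivity

theorem map_bezoutSum {S : Type*} [CommRing S] (f : R →+* S) (r : ℕ) (c s : R) :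
    f (bezoutSum r c s) = bezoutSum r (f c) (f s) := by
  simp [bezoutSum, map_sum]

end Bezout

/-! ### The dual mask and the interpolatory mask as Laurent polynomials -/

section Laurent

open LaurentPolynomial

theorem coeff_T_mul (k : ℤ) (P : LaurentPolynomial ℝ) (n : ℤ) :
    (T k * P).coeff n = P.coeff (n - k) := by
  induction P using LaurentPolynomial.induction_on' with
  | add p q hp hq =>
    simp only [mul_add, AddMonoidAlgebra.coeff_add, Finsupp.add_apply, hp, hq]
  | C_mul_T m a =>
    rw [mul_left_comm, ← T_add, ← LaurentPolynomial.smul_eq_C_mul, ← LaurentPolynomial.smul_eq_C_mul]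
    simp [eq_sub_iff_add_eq, add_comm]

/-- The substitution `z ↦ -z`. -/
noncomputable def negVar : LaurentPolynomial ℝ →+* LaurentPolynomial ℝ :=
  eval₂ LaurentPolynomial.C (-(LaurentPolynomial.isUnit_T (R := ℝ) 1).unit)

theorem negVar_T (n : ℤ) :
    negVar (T n) = LaurentPolynomial.C ((-1 : ℝ) ^ n) * T n := by
  have hu : (-(LaurentPolynomial.isUnit_T (R := ℝ) 1).unit) =
      (-1 : (LaurentPolynomial ℝ)ˣ) * (LaurentPolynomial.isUnit_T (R := ℝ) 1).unit := by simp
  have hT : (((LaurentPolynomial.isUnit_T (R := ℝ) 1).unit ^ n : (LaurentPolynomial ℝ)ˣ) :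
      LaurentPolynomial ℝ) = T n := by
    induction n using Int.induction_on with
    | zero => simp
    | succ n ih => rw [zpow_add_one, Units.val_mul, ih, IsUnit.unit_spec, ← T_add]
    | pred n ih =>
      rw [zpow_sub_one, Units.val_mul, ih, sub_eq_add_neg, T_add]
      congr 1
      refine Units.inv_eq_of_mul_eq_one_right ?_
      rw [IsUnit.unit_spec, ← T_add]
      simp
  rw [negVar, eval₂_T, hu, mul_zpow, Units.val_mul, hT]
  congr 1
  rcases Int.even_or_odd n with h | h <;> simp [h.neg_one_zpow]

theorem negVar_C (a : ℝ) : negVar (LaurentPolynomial.C a) = LaurentPolynomial.C a := by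
  simp [negVar]

theorem coeff_negVar (P : LaurentPolynomial ℝ) (n : ℤ) :
    (negVar P).coeff n = (-1) ^ n * P.coeff n := by
  induction P using LaurentPolynomial.induction_on' with
  | add p q hp hq => simp [mul_add, hp, hq]
  | C_mul_T m a =>
    rw [map_mul, negVar_C, negVar_T, ← mul_assoc, ← map_mul, ← LaurentPolynomial.smul_eq_C_mul,
      ← LaurentPolynomial.smul_eq_C_mul]
    by_cases h : m = n
    · subst h; simp [mul_comm]
    · simp [h]

theorem cosSq_add_sinSq : cosSq + sinSq = 1 := by
  have : cosSq + sinSq = LaurentPolynomial.C (1 / 4) * LaurentPolynomial.C (4 : ℝ) := by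
    unfold cosSq sinSq
    rw [← mul_add, show (LaurentPolynomial.C (4 : ℝ)) = 4 from map_ofNat _ 4]
    ring
  rw [this, ← map_mul]
  norm_num

theorem negVar_cosSq : negVar cosSq = sinSq := by
  simp only [cosSq, sinSq, map_mul, negVar_C, map_add, negVar_T, map_ofNat]
  simp
  ring

theorem negVar_sinSq : negVar sinSq = cosSq := by
  simp only [cosSq, sinSq, map_mul, negVar_C, map_sub, negVar_T, map_ofNat]
  simp

theorem invert_cosSq : invert cosSq = cosSq := by
  simp only [cosSq, map_mul, map_add, invert_T, invert_C, map_ofNat]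
  simp
  ring

theorem invert_sinSq : invert sinSq = sinSq := by
  simp only [sinSq, map_mul, map_sub, invert_T, invert_C, map_ofNat]
  simp
  ring

/-- The Laurent polynomial `2 cos(ξ/2)^(2r+2) ∑_{n ≤ r} binom(r+n, n) sin(ξ/2)^(2n)`, the symbol of
the Deslauriers-Dubuc interpolatory subdivision scheme. -/
noncomputable def interpMask (mt : ℕ) : LaurentPolynomial ℝ :=
  2 * bezoutSum ((mt - 1) / 2) cosSq sinSq

/-- Since `(1 + z)(1 + z⁻¹) = 4 cos²(ξ/2)`, the extra factor completes the power of the cosine to `r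
+ 1`. This ties the CDF filter to interpolatory subdivision. -/
theorem one_add_T_mul_dualMask (mt : ℕ) :
    (1 + T (-1)) * dualMask mt = 2 * interpMask mt := by
  have h4 : (1 + T 1) * (1 + T (-1)) = 4 * cosSq := by
    unfold cosSq
    rw [← mul_assoc, show (4 : LaurentPolynomial ℝ) = LaurentPolynomial.C (4 : ℝ) from
      (map_ofNat _ 4).symm, ← map_mul, add_mul, mul_add, mul_add, ← T_add]
    norm_num
    ring
  rw [dualMask, interpMask, bezoutSum, pow_succ']
  simp only [map_natCast]
  linear_combination (cosSq ^ ((mt - 1) / 2) * ∑ n ∈ Finset.range ((mt - 1) / 2 + 1),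
      ((((mt - 1) / 2 + n).choose n : ℕ) : LaurentPolynomial ℝ) * sinSq ^ n) * h4

theorem interpMask_coeff (mt : ℕ) (n : ℤ) :
    (interpMask mt).coeff n = ((dualMask mt).coeff n + (dualMask mt).coeff (n + 1)) / 2 := by
  have h := congrArg (fun P : LaurentPolynomial ℝ => P.coeff n) (one_add_T_mul_dualMask mt)
  simp only [add_mul, one_mul, two_mul] at h
  simp only [AddMonoidAlgebra.coeff_add, Finsupp.add_apply, coeff_T_mul, sub_neg_eq_add] at h
  linarith

theorem interpMask_coeff_neg (mt : ℕ) (n : ℤ) :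
    (interpMask mt).coeff (-n) = (interpMask mt).coeff n := by
  have h : invert (interpMask mt) = interpMask mt := by
    have := map_bezoutSum (invert (R := ℝ) : LaurentPolynomial ℝ →+* LaurentPolynomial ℝ)
      ((mt - 1) / 2) cosSq sinSq
    rw [interpMask, map_mul, map_ofNat]
    congr 1
    simpa [invert_cosSq, invert_sinSq] using this
  rw [← invert_apply, h]

/-- Replacing `z` by `-z` swaps `cos²` and `sin²`, so the Bezout identity reads `A(z) + A(-z) = 2`:
the even part of the mask is the constant 1. -/
theorem interpMask_coeff_even (mt : ℕ) (n : ℤ) :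
    (interpMask mt).coeff (2 * n) = if n = 0 then 1 else 0 := by
  have h : interpMask mt + negVar (interpMask mt) = 1 + 1 := by
    rw [interpMask, map_mul, map_bezoutSum, negVar_cosSq, negVar_sinSq, map_ofNat, ← mul_add,
      bezoutSum_add_swap _ cosSq_add_sinSq]
    norm_num
  have h' := congrArg (fun P : LaurentPolynomial ℝ => P.coeff (2 * n)) h
  simp only [AddMonoidAlgebra.coeff_add, Finsupp.add_apply, coeff_negVar] at h'
  rw [(even_two_mul n).neg_one_zpow, ← T_zero, T_apply] at h'
  split_ifs with hn
  · subst hn; simp at h'; simp; linarith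
  · simp only [if_neg (show ¬ (0 : ℤ) = 2 * n by omega)] at h'
    linarith

/-- Evaluation at `z = e^{iξ}`. -/
theorem sum_interpMask_coeff_cos (mt : ℕ) (ξ : ℝ) :
    ∑ n ∈ (interpMask mt).coeff.support, (interpMask mt).coeff n * Real.cos (n * ξ) =
      2 * bezoutSum ((mt - 1) / 2) (Real.cos (ξ / 2) ^ 2) (Real.sin (ξ / 2) ^ 2) := by
  set e : ℂˣ := Units.mk0 (Complex.exp (ξ * Complex.I)) (Complex.exp_ne_zero _) with he
  have hT : ∀ n : ℤ, eval₂ Complex.ofRealHom e (T n) = Complex.exp ((n * ξ : ℝ) * Complex.I) := by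
    intro n
    rw [eval₂_T, Units.val_zpow_eq_zpow_val, he, Units.val_mk0, ← Complex.exp_int_mul]
    push_cast
    ring_nf
  have hgen : ∀ P : LaurentPolynomial ℝ,
      (eval₂ Complex.ofRealHom e P).re = P.coeff.sum fun n a => a * Real.cos (n * ξ) := by
    intro P
    induction P using LaurentPolynomial.induction_on' with
    | add p q hp hq =>
      rw [map_add, Complex.add_re, hp, hq, AddMonoidAlgebra.coeff_add,
        Finsupp.sum_add_index' (by simp) (by intros; ring)]
    | C_mul_T m a =>
      rw [← single_eq_C_mul_T, AddMonoidAlgebra.coeff_single, Finsupp.sum_single_index (by simp),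
        single_eq_C_mul_T, map_mul, hT, eval₂_C]
      rw [Complex.ofRealHom_eq_coe, Complex.re_ofReal_mul, Complex.exp_ofReal_mul_I_re]
  have h4 : ∀ a : ℝ, eval₂ Complex.ofRealHom e (LaurentPolynomial.C a) = (a : ℂ) := by simp
  have hcos : eval₂ Complex.ofRealHom e (T 1) + eval₂ Complex.ofRealHom e (T (-1)) =
      2 * (Real.cos ξ : ℂ) := by
    rw [hT, hT, Complex.ofReal_cos, Complex.two_cos]
    push_cast
    ring_nf
  have hc : eval₂ Complex.ofRealHom e cosSq = ((Real.cos (ξ / 2) ^ 2 : ℝ) : ℂ) := by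
    rw [Real.cos_sq, cosSq, map_mul, h4, map_add, map_add, add_assoc, hcos, map_ofNat]
    push_cast
    ring_nf
  have hs : eval₂ Complex.ofRealHom e sinSq = ((Real.sin (ξ / 2) ^ 2 : ℝ) : ℂ) := by
    rw [Real.sin_sq, Real.cos_sq, sinSq, map_mul, h4, map_sub, map_sub, sub_sub, hcos, map_ofNat]
    push_cast
    ring_nf
  have hmain := hgen (interpMask mt)
  rw [interpMask, map_mul, map_bezoutSum, hc, hs, map_ofNat,
    ← Complex.coe_algebraMap, ← map_bezoutSum] at hmain
  rw [Finsupp.sum] at hmain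
  rw [interpMask, ← hmain]
  simp

end Laurent

/-! ### The symbol on the frequency side -/

/-- The symbol `∑ α_n cos(nξ)` of the interpolatory mask. -/
noncomputable def interpSymbol (mt : ℕ) (ξ : ℝ) : ℝ :=
  2 * bezoutSum ((mt - 1) / 2) (Real.cos (ξ / 2) ^ 2) (Real.sin (ξ / 2) ^ 2)

theorem continuous_interpSymbol (mt : ℕ) : Continuous (interpSymbol mt) := by
  unfold interpSymbol bezoutSum
  fun_prop

theorem interpSymbol_nonneg (mt : ℕ) (ξ : ℝ) : 0 ≤ interpSymbol mt ξ :=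
  mul_nonneg zero_le_two (bezoutSum_nonneg _ (sq_nonneg _) (sq_nonneg _))

theorem interpSymbol_add_pi (mt : ℕ) (ξ : ℝ) :
    interpSymbol mt (ξ + Real.pi) = 2 - interpSymbol mt ξ := by
  have h := bezoutSum_add_swap ((mt - 1) / 2) (Real.cos_sq_add_sin_sq (ξ / 2))
  have e : (ξ + Real.pi) / 2 = ξ / 2 + Real.pi / 2 := by ring
  rw [interpSymbol, interpSymbol, e, Real.cos_add_pi_div_two, Real.sin_add_pi_div_two, neg_sq]
  linarith

theorem interpSymbol_periodic (mt : ℕ) : Function.Periodic (interpSymbol mt) (2 * Real.pi) := by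
  intro ξ
  rw [two_mul, ← add_assoc, interpSymbol_add_pi, interpSymbol_add_pi]
  ring

/-- Where `cos ξ ≥ 0`, monotonicity in `r` gives `A - 1 ≥ cos ξ`, the case `r = 0` being equality.
Both `A - 1` and `cos` change sign under `ξ ↦ ξ + π`, which covers `cos ξ ≤ 0`. -/
theorem one_sub_cos_sq_le (mt : ℕ) (ξ : ℝ) :
    1 - Real.cos ξ * (interpSymbol mt ξ - 1) ≤ 1 - Real.cos ξ ^ 2 := by
  have key : ∀ η : ℝ, 0 ≤ Real.cos η → Real.cos η ≤ interpSymbol mt η - 1 := by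
    intro η h
    have h1 := Real.cos_sq_add_sin_sq (η / 2)
    have h2 : Real.cos η = 2 * Real.cos (η / 2) ^ 2 - 1 := by
      rw [← Real.cos_two_mul]; ring_nf
    have := le_bezoutSum ((mt - 1) / 2) h1 (sq_nonneg _) (by linarith)
    rw [interpSymbol]
    linarith
  rcases le_total 0 (Real.cos ξ) with h | h
  · nlinarith [key ξ h]
  · have h' := key (ξ + Real.pi) (by rw [Real.cos_add_pi]; linarith)
    rw [Real.cos_add_pi, interpSymbol_add_pi] at h'
    nlinarith

/-! ### Iterated symbols and decay of the subdivision kernel -/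

/-- `∏_{j < J} A(2^j ξ)` for the interpolatory symbol `A`. -/
noncomputable def symbolProd (mt J : ℕ) (ξ : ℝ) : ℝ :=
  ∏ j ∈ Finset.range J, interpSymbol mt (2 ^ j * ξ)

theorem continuous_symbolProd (mt J : ℕ) : Continuous (symbolProd mt J) := by
  unfold symbolProd
  have := continuous_interpSymbol mt
  fun_prop

theorem symbolProd_nonneg (mt J : ℕ) (ξ : ℝ) : 0 ≤ symbolProd mt J ξ :=
  Finset.prod_nonneg fun _ _ => interpSymbol_nonneg _ _

theorem symbolProd_succ (mt J : ℕ) (ξ : ℝ) :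
    symbolProd mt (J + 1) ξ = symbolProd mt J ξ * interpSymbol mt (2 ^ J * ξ) :=
  Finset.prod_range_succ _ _

theorem symbolProd_succ' (mt J : ℕ) (ξ : ℝ) :
    symbolProd mt (J + 1) ξ = interpSymbol mt ξ * symbolProd mt J (2 * ξ) := by
  rw [symbolProd, Finset.prod_range_succ', mul_comm, symbolProd, pow_zero, one_mul]
  simp only [pow_succ, mul_assoc]

theorem symbolProd_periodic (mt J : ℕ) : Function.Periodic (symbolProd mt J) (2 * Real.pi) := by
  intro ξ
  refine Finset.prod_congr rfl fun j _ => ?_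
  have h := (interpSymbol_periodic mt).nat_mul (2 ^ j) (2 ^ j * ξ)
  rw [mul_add]
  push_cast at h
  exact h

/-- The coefficients of `∏_{j < J} A(z^(2^j))` for the interpolatory symbol `A`. -/
noncomputable def subdivKernel (mt J : ℕ) (n : ℤ) : ℝ :=
  (2 * Real.pi)⁻¹ * ∫ ξ in (0 : ℝ)..2 * Real.pi, Real.cos (n * ξ) * symbolProd mt J ξ

theorem subdivKernel_zero (mt : ℕ) (n : ℤ) : subdivKernel mt 0 n = if n = 0 then 1 else 0 := by
  have hpi := Real.pi_pos.ne'
  unfold subdivKernel symbolProd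
  split_ifs with h
  · subst h
    simp
    field_simp
  · have hn : (n : ℝ) ≠ 0 := by exact_mod_cast h
    have : Real.sin (n * (2 * Real.pi)) = 0 := by
      have := Real.sin_int_mul_pi (n * 2)
      push_cast at this
      rw [← this]; ring_nf
    simp [intervalIntegral.integral_comp_mul_left, hn, this]

theorem sum_interpMask_coeff_sin (mt : ℕ) (ξ : ℝ) :
    ∑ m ∈ (interpMask mt).coeff.support, (interpMask mt).coeff m * Real.sin (m * ξ) = 0 := by
  have h : ∑ m ∈ (interpMask mt).coeff.support, (interpMask mt).coeff m * Real.sin (m * ξ) =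
      ∑ m ∈ (interpMask mt).coeff.support, -((interpMask mt).coeff m * Real.sin (m * ξ)) := by
    refine Finset.sum_equiv (Equiv.neg ℤ) (fun i => ?_) (fun i _ => ?_)
    · simp [interpMask_coeff_neg]
    · simp [interpMask_coeff_neg]
  rw [Finset.sum_neg_distrib] at h
  linarith

theorem subdivKernel_succ (mt J : ℕ) (n : ℤ) :
    subdivKernel mt (J + 1) n = ∑ m ∈ (interpMask mt).coeff.support,
      (interpMask mt).coeff m * subdivKernel mt J (n - 2 ^ J * m) := by
  unfold subdivKernel
  have hc := continuous_symbolProd mt J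
  simp_rw [mul_left_comm _ ((2 * Real.pi)⁻¹), ← Finset.mul_sum,
    ← intervalIntegral.integral_const_mul]
  rw [← intervalIntegral.integral_finsetSum
    (fun i _ => (by fun_prop : Continuous _).intervalIntegrable _ _)]
  rw [intervalIntegral.integral_const_mul]
  refine congrArg _ (intervalIntegral.integral_congr fun ξ _ => ?_)
  have h1 := sum_interpMask_coeff_cos mt (2 ^ J * ξ)
  rw [← interpSymbol] at h1
  have h2 := sum_interpMask_coeff_sin mt (2 ^ J * ξ)
  have h3 : ∑ m ∈ (interpMask mt).coeff.support, (interpMask mt).coeff m *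
      (Real.cos (((n - 2 ^ J * m : ℤ) : ℝ) * ξ) * symbolProd mt J ξ) =
      symbolProd mt J ξ * (Real.cos (n * ξ) * ∑ m ∈ (interpMask mt).coeff.support,
        (interpMask mt).coeff m * Real.cos (m * (2 ^ J * ξ)) +
      Real.sin (n * ξ) * ∑ m ∈ (interpMask mt).coeff.support,
        (interpMask mt).coeff m * Real.sin (m * (2 ^ J * ξ))) := by
    rw [Finset.mul_sum, Finset.mul_sum, ← Finset.sum_add_distrib, Finset.mul_sum]
    refine Finset.sum_congr rfl fun m _ => ?_
    have : ((n - 2 ^ J * m : ℤ) : ℝ) * ξ = n * ξ - m * (2 ^ J * ξ) := by push_cast; ring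
    rw [this, Real.cos_sub]
    ring
  rw [h3, h1, h2, symbolProd_succ]
  ring

/-- Iterated interpolatory subdivision stays interpolatory. The case `k = 0` also says that the
nonnegative product of symbols has mean 1. -/
theorem subdivKernel_two_pow_mul (mt J : ℕ) (k : ℤ) :
    subdivKernel mt J (2 ^ J * k) = if k = 0 then 1 else 0 := by
  induction J generalizing k with
  | zero => simp [subdivKernel_zero]
  | succ J ih =>
    rw [subdivKernel_succ]
    have h : ∀ m : ℤ, (2 : ℤ) ^ (J + 1) * k - 2 ^ J * m = 2 ^ J * (2 * k - m) := by
      intro m; ring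
    simp_rw [h, ih, sub_eq_zero, mul_ite, mul_one, mul_zero]
    rw [Finset.sum_ite_eq, interpMask_coeff_even]
    split_ifs with h1 h2 h2 <;> try rfl
    simp [h2] at h1
    have := interpMask_coeff_even mt 0
    simp [h1] at this

theorem integral_comp_two_mul_periodic {g : ℝ → ℝ} (hg : Continuous g)
    (hp : Function.Periodic g (2 * Real.pi)) :
    ∫ ξ in (0 : ℝ)..2 * Real.pi, g (2 * ξ) = ∫ ξ in (0 : ℝ)..2 * Real.pi, g ξ := by
  rw [intervalIntegral.integral_comp_mul_left _ two_ne_zero, mul_zero,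
    ← intervalIntegral.integral_add_adjacent_intervals
      (hg.intervalIntegrable 0 (2 * Real.pi)) (hg.intervalIntegrable _ _)]
  have := hp.intervalIntegral_add_eq (2 * Real.pi) 0
  rw [zero_add, ← two_mul] at this
  rw [this, smul_eq_mul]
  ring

/-- This measures how the density `symbolProd` concentrates at frequency 0: each further factor
halves the mean of `1 - cos ξ`. -/
theorem integral_one_sub_cos_mul_symbolProd_le (mt J : ℕ) :
    ∫ ξ in (0 : ℝ)..2 * Real.pi, (1 - Real.cos ξ) * symbolProd mt J ξ ≤
      2 * Real.pi * (1 / 2) ^ J := by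
  induction J with
  | zero => simp [symbolProd]
  | succ J ih =>
    have hc := continuous_symbolProd mt J
    have hc' := continuous_symbolProd mt (J + 1)
    set h : ℝ → ℝ := fun ξ => (1 - Real.cos ξ) * symbolProd mt (J + 1) ξ with hh
    have hcont : Continuous h := by fun_prop
    have hper : Function.Periodic h (2 * Real.pi) := fun ξ => by
      simp only [hh, Real.cos_add_two_pi, symbolProd_periodic mt (J + 1) ξ]
    have hshift : ∫ ξ in (0 : ℝ)..2 * Real.pi, h (ξ + Real.pi) =
        ∫ ξ in (0 : ℝ)..2 * Real.pi, h ξ := by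
      rw [intervalIntegral.integral_comp_add_right, zero_add]
      have := hper.intervalIntegral_add_eq Real.pi 0
      rwa [zero_add, add_comm Real.pi] at this
    -- Folding `ξ` with `ξ + π` gives `(1 - cos)A + (1 + cos)(2 - A) = 2(1 - cos·(A - 1))`, at most
    -- `2 sin² ξ = 1 - cos 2ξ`. The left integral is twice that of `h`, the right one is the
    -- integral for `J`.
    have hle : ∫ ξ in (0 : ℝ)..2 * Real.pi, (h ξ + h (ξ + Real.pi)) ≤
        ∫ ξ in (0 : ℝ)..2 * Real.pi, (fun η => (1 - Real.cos η) * symbolProd mt J η) (2 * ξ) := by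
      refine intervalIntegral.integral_mono_on (by positivity)
        (Continuous.intervalIntegrable (by fun_prop) _ _)
        (Continuous.intervalIntegrable (by fun_prop) _ _) fun ξ _ => ?_
      have e := symbolProd_periodic mt J (2 * ξ)
      simp only [hh]
      rw [symbolProd_succ', symbolProd_succ', interpSymbol_add_pi, Real.cos_add_pi, mul_add, e,
        Real.cos_two_mul]
      have h1 := one_sub_cos_sq_le mt ξ
      have h2 := symbolProd_nonneg mt J (2 * ξ)
      nlinarith [mul_le_mul_of_nonneg_right h1 h2]
    rw [integral_comp_two_mul_periodic (g := fun η => (1 - Real.cos η) * symbolProd mt J η)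
      (by fun_prop) (fun ξ => by
        simp only [Real.cos_add_two_pi, symbolProd_periodic mt J ξ]),
      intervalIntegral.integral_add (hcont.intervalIntegrable _ _)
      (Continuous.intervalIntegrable (by fun_prop) _ _), hshift] at hle
    rw [pow_succ]
    linarith

theorem sin_int_mul_sq_le (n : ℤ) (θ : ℝ) :
    Real.sin (n * θ) ^ 2 ≤ (n : ℝ) ^ 2 * Real.sin θ ^ 2 := by
  have key : ∀ m : ℕ, |Real.sin (m * θ)| ≤ m * |Real.sin θ| := by
    intro m
    induction m with
    | zero => simp
    | succ m ih =>
      push_cast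
      rw [add_mul, one_mul, Real.sin_add]
      refine (abs_add_le _ _).trans ?_
      rw [abs_mul, abs_mul, add_mul, one_mul]
      have h1 := Real.abs_cos_le_one θ
      have h2 := Real.abs_cos_le_one (m * θ)
      nlinarith [abs_nonneg (Real.sin θ), abs_nonneg (Real.sin (m * θ))]
  have h := key n.natAbs
  have e : |Real.sin (n * θ)| = |Real.sin ((n.natAbs : ℝ) * θ)| := by
    rcases Int.natAbs_eq n with h | h
    · conv_lhs => rw [h]
      simp
    · conv_lhs => rw [h]
      simp only [Int.cast_neg, Int.cast_natCast, neg_mul, Real.sin_neg, abs_neg]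
  rw [← e] at h
  have h2 : ((n.natAbs : ℝ)) ^ 2 = (n : ℝ) ^ 2 := by
    rw [Nat.cast_natAbs, Int.cast_abs, sq_abs]
  rw [← sq_abs, ← sq_abs (Real.sin θ), ← h2, ← mul_pow]
  exact pow_le_pow_left₀ (abs_nonneg _) h 2

/-- The kernel vanishes at `2^J k`, so only a difference of two cosines is integrated. That
difference is small near `ξ = 0`, where the density concentrates. Taking `δ = 2^{-J/2}` later makes
the bound `O(2^{-J/2})`. -/
theorem abs_subdivKernel_le (mt J : ℕ) (x k : ℤ) (hk : k ≠ 0) {δ : ℝ} (hδ : 0 < δ) :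
    |subdivKernel mt J (x - 2 ^ J * k)| ≤ δ + (x : ℝ) ^ 2 / (2 * δ) * (1 / 2) ^ J := by
  have hc := continuous_symbolProd mt J
  have h0 : ∫ ξ in (0 : ℝ)..2 * Real.pi, symbolProd mt J ξ = 2 * Real.pi := by
    have := subdivKernel_two_pow_mul mt J 0
    simp only [subdivKernel, mul_zero, Int.cast_zero, zero_mul, Real.cos_zero, one_mul, if_true]
      at this
    field_simp at this
    linarith
  have hN : ∫ ξ in (0 : ℝ)..2 * Real.pi, Real.cos (((2 ^ J * k : ℤ) : ℝ) * ξ) * symbolProd mt J ξ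
      = 0 := by
    have := subdivKernel_two_pow_mul mt J k
    rw [if_neg hk, subdivKernel] at this
    exact (mul_eq_zero.1 this).resolve_left (by positivity)
  have hbound : |∫ ξ in (0 : ℝ)..2 * Real.pi,
      Real.cos (((x - 2 ^ J * k : ℤ) : ℝ) * ξ) * symbolProd mt J ξ| ≤
      ∫ ξ in (0 : ℝ)..2 * Real.pi, (δ * symbolProd mt J ξ +
        (x : ℝ) ^ 2 / (2 * δ) * ((1 - Real.cos ξ) * symbolProd mt J ξ)) := by
    have : ∫ ξ in (0 : ℝ)..2 * Real.pi,
        Real.cos (((x - 2 ^ J * k : ℤ) : ℝ) * ξ) * symbolProd mt J ξ =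
        ∫ ξ in (0 : ℝ)..2 * Real.pi, (Real.cos (((x - 2 ^ J * k : ℤ) : ℝ) * ξ) * symbolProd mt J ξ
          - Real.cos (((2 ^ J * k : ℤ) : ℝ) * ξ) * symbolProd mt J ξ) := by
      rw [intervalIntegral.integral_sub, hN, sub_zero] <;>
      exact Continuous.intervalIntegrable (by fun_prop) _ _
    rw [this]
    refine (intervalIntegral.abs_integral_le_integral_abs (by positivity)).trans ?_
    refine intervalIntegral.integral_mono_on (by positivity)
        (Continuous.intervalIntegrable (by fun_prop) _ _)
        (Continuous.intervalIntegrable (by fun_prop) _ _) fun ξ _ => ?_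
    rw [← sub_mul, abs_mul, abs_of_nonneg (symbolProd_nonneg _ _ _)]
    have h2 := symbolProd_nonneg mt J ξ
    suffices |Real.cos (((x - 2 ^ J * k : ℤ) : ℝ) * ξ) - Real.cos (((2 ^ J * k : ℤ) : ℝ) * ξ)| ≤
        δ + (x : ℝ) ^ 2 / (2 * δ) * (1 - Real.cos ξ) by
      nlinarith [mul_le_mul_of_nonneg_right this h2]
    have e : Real.cos (((x - 2 ^ J * k : ℤ) : ℝ) * ξ) - Real.cos (((2 ^ J * k : ℤ) : ℝ) * ξ) =
        2 * (Real.sin ((2 ^ J * k - x / 2) * ξ) * Real.sin (x * (ξ / 2))) := by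
      rw [← Real.cos_neg (((x - 2 ^ J * k : ℤ) : ℝ) * ξ), Real.cos_sub_cos]
      push_cast
      have e1 : (-((x - 2 ^ J * k : ℝ) * ξ) + 2 ^ J * k * ξ) / 2 = (2 ^ J * k - x / 2) * ξ := by
        ring
      have e2 : (-((x - 2 ^ J * k : ℝ) * ξ) - 2 ^ J * k * ξ) / 2 = -(x * (ξ / 2)) := by ring
      rw [e1, e2, Real.sin_neg]
      ring
    have hs := sin_int_mul_sq_le x (ξ / 2)
    have hcos : Real.cos ξ = 1 - 2 * Real.sin (ξ / 2) ^ 2 := by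
      have := Real.cos_two_mul' (ξ / 2)
      rw [Real.cos_sq', show 2 * (ξ / 2) = ξ by ring] at this
      linarith
    have h3 : |Real.sin (x * (ξ / 2))| ^ 2 ≤ (x : ℝ) ^ 2 * Real.sin (ξ / 2) ^ 2 := by
      rwa [sq_abs]
    rw [e, hcos, abs_mul, abs_mul, abs_two]
    set y := |Real.sin (x * (ξ / 2))|
    have h4 := Real.abs_sin_le_one ((2 ^ J * k - x / 2) * ξ)
    have h5 : 0 ≤ y := abs_nonneg _
    -- The arithmetic-geometric mean inequality trades the first power of the sine for its square,
    -- which the bound on the mean of `1 - cos ξ` controls.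
    have h6 : 2 * y ≤ δ + y ^ 2 / δ := by
      rw [← sub_nonneg]
      have : δ + y ^ 2 / δ - 2 * y = (δ - y) ^ 2 / δ := by field_simp; ring
      rw [this]; positivity
    have h7 : y ^ 2 / δ ≤ (x : ℝ) ^ 2 * Real.sin (ξ / 2) ^ 2 / δ := by gcongr
    have h8 : (x : ℝ) ^ 2 / (2 * δ) * (1 - (1 - 2 * Real.sin (ξ / 2) ^ 2)) =
        (x : ℝ) ^ 2 * Real.sin (ξ / 2) ^ 2 / δ := by field_simp; ring
    rw [h8]
    nlinarith
  rw [intervalIntegral.integral_add (Continuous.intervalIntegrable (by fun_prop) _ _)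
    (Continuous.intervalIntegrable (by fun_prop) _ _), intervalIntegral.integral_const_mul,
    intervalIntegral.integral_const_mul, h0] at hbound
  have hI := integral_one_sub_cos_mul_symbolProd_le mt J
  rw [subdivKernel, abs_mul, abs_of_pos (by positivity), inv_mul_le_iff₀ (by positivity)]
  refine hbound.trans ?_
  have := mul_le_mul_of_nonneg_left hI (show 0 ≤ (x : ℝ) ^ 2 / (2 * δ) by positivity)
  nlinarith

/-! ### Unitary dilations and translations -/

section Affine

theorem map_affine_volume {a : ℝ} (ha : 0 < a) (b : ℝ) :
    Measure.map (fun x : ℝ => a * x - b) volume = ENNReal.ofReal a⁻¹ • volume := by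
  have h : (fun x : ℝ => a * x - b) = (fun x => x - b) ∘ (fun x => a * x) := rfl
  rw [h, ← Measure.map_map (by fun_prop) (by fun_prop), Real.map_volume_mul_left ha.ne',
    Measure.map_smul, (measurePreserving_sub_right volume b).map_eq, abs_of_pos (inv_pos.2 ha)]

theorem quasiMeasurePreserving_affine {a : ℝ} (ha : 0 < a) (b : ℝ) :
    Measure.QuasiMeasurePreserving (fun x : ℝ => a * x - b) volume volume := by
  refine ⟨by fun_prop, ?_⟩
  rw [map_affine_volume ha]
  exact Measure.smul_absolutelyContinuous

theorem memLp_comp_affine {a : ℝ} (ha : 0 < a) (b : ℝ) {f : ℝ → ℂ} (hf : MemLp f 2 volume) :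
    MemLp (fun x => f (a * x - b)) 2 volume := by
  have h : MemLp f 2 (Measure.map (fun x : ℝ => a * x - b) volume) := by
    rw [map_affine_volume ha]
    exact hf.smul_measure ENNReal.ofReal_ne_top
  exact h.comp_of_map (by fun_prop)

/-- The unitary operator `f ↦ √a f(a · - b)` on `L₂(ℝ)`. -/
noncomputable def affineIsometry (a : ℝ) (ha : 0 < a) (b : ℝ) : L2R →ₗᵢ[ℂ] L2R :=
  LinearMap.isometryOfInner
    { toFun := fun f => ((memLp_comp_affine ha b (Lp.memLp f)).const_mul ((√a : ℝ) : ℂ)).toLp _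
      map_add' := fun f g => by
        rw [← MemLp.toLp_add]
        refine MemLp.toLp_congr _ _ ?_
        filter_upwards [(quasiMeasurePreserving_affine ha b).ae (Lp.coeFn_add f g)] with x hx
        simp only [Pi.add_apply] at hx ⊢
        rw [hx, mul_add]
      map_smul' := fun c f => by
        rw [RingHom.id_apply, ← MemLp.toLp_const_smul]
        refine MemLp.toLp_congr _ _ ?_
        filter_upwards [(quasiMeasurePreserving_affine ha b).ae (Lp.coeFn_smul c f)] with x hx
        simp only [Pi.smul_apply, smul_eq_mul] at hx ⊢
        rw [hx, mul_left_comm] }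
    (fun f g => by
      rw [L2.inner_def, L2.inner_def]
      have h : ∀ᵐ x : ℝ, inner ℂ ((((memLp_comp_affine ha b (Lp.memLp f)).const_mul
            ((√a : ℝ) : ℂ)).toLp _ : L2R) x)
          ((((memLp_comp_affine ha b (Lp.memLp g)).const_mul ((√a : ℝ) : ℂ)).toLp _ : L2R) x) =
          (fun y => (a : ℂ) * inner ℂ (f (y - b)) (g (y - b))) (a * x) := by
        filter_upwards [MemLp.coeFn_toLp ((memLp_comp_affine ha b (Lp.memLp f)).const_mul
            ((√a : ℝ) : ℂ)), MemLp.coeFn_toLp ((memLp_comp_affine ha b (Lp.memLp g)).const_mul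
            ((√a : ℝ) : ℂ))] with x h1 h2
        have hs : ((√a : ℝ) : ℂ) * ((√a : ℝ) : ℂ) = a := by
          rw [← Complex.ofReal_mul, Real.mul_self_sqrt ha.le]
        rw [h1, h2]
        simp only [RCLike.inner_apply, map_mul, Complex.conj_ofReal]
        rw [← hs]
        ring
      refine (integral_congr_ae h).trans ?_
      rw [Measure.integral_comp_mul_left (fun y => (a : ℂ) * inner ℂ (f (y - b)) (g (y - b))) a, abs_of_pos (inv_pos.2 ha), integral_const_mul,
        integral_sub_right_eq_self (fun y => inner ℂ (f y) (g y)) b, Complex.real_smul, ← mul_assoc,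
        ← Complex.ofReal_mul, inv_mul_cancel₀ ha.ne', Complex.ofReal_one, one_mul])

theorem coeFn_affineIsometry (a : ℝ) (ha : 0 < a) (b : ℝ) (f : L2R) :
    affineIsometry a ha b f =ᵐ[volume] fun x => ((√a : ℝ) : ℂ) * f (a * x - b) :=
  MemLp.coeFn_toLp ((memLp_comp_affine ha b (Lp.memLp f)).const_mul ((√a : ℝ) : ℂ))

theorem affineIsometry_apply_of_ae {a : ℝ} (ha : 0 < a) (b : ℝ) {f : L2R} {f' : ℝ → ℂ}
    (h : f =ᵐ[volume] f') :
    affineIsometry a ha b f =ᵐ[volume] fun x => ((√a : ℝ) : ℂ) * f' (a * x - b) := by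
  filter_upwards [coeFn_affineIsometry a ha b f, (quasiMeasurePreserving_affine ha b).ae h]
    with x h1 h2
  rw [h1, h2]

theorem affineIsometry_comp {a c : ℝ} (ha : 0 < a) (hc : 0 < c) (b d : ℝ) (f : L2R) :
    affineIsometry a ha b (affineIsometry c hc d f) =
      affineIsometry (c * a) (mul_pos hc ha) (c * b + d) f := by
  refine Lp.ext ?_
  filter_upwards [affineIsometry_apply_of_ae ha b (coeFn_affineIsometry c hc d f),
    coeFn_affineIsometry (c * a) (mul_pos hc ha) (c * b + d) f] with x h1 h2
  rw [h1, h2, Real.sqrt_mul hc.le, ← mul_assoc, ← Complex.ofReal_mul, mul_comm (√a),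
    show c * (a * x - b) - d = c * a * x - (c * b + d) by ring]

theorem affineIsometry_one_zero (f : L2R) : affineIsometry 1 one_pos 0 f = f := by
  refine Lp.ext ?_
  filter_upwards [coeFn_affineIsometry 1 one_pos 0 f] with x h1
  simp [h1]

/-- The operator `f ↦ 2^{j/2} f(2^j · - k)`. -/
noncomputable def dilTrans (j k : ℤ) : L2R →ₗᵢ[ℂ] L2R :=
  affineIsometry ((2 : ℝ) ^ j) (by positivity) k

theorem two_rpow_half (j : ℤ) : (2 : ℝ) ^ ((j : ℝ) / 2) = √((2 : ℝ) ^ j) := by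
  rw [Real.sqrt_eq_rpow, ← Real.rpow_intCast, ← Real.rpow_mul zero_le_two]
  ring_nf

theorem dilTrans_ae (j k : ℤ) {f : L2R} {f' : ℝ → ℂ} (h : f =ᵐ[volume] f') :
    dilTrans j k f =ᵐ[volume]
      fun x => (((2 : ℝ) ^ ((j : ℝ) / 2) : ℝ) : ℂ) * f' ((2 : ℝ) ^ j * x - k) := by
  rw [two_rpow_half]
  exact affineIsometry_apply_of_ae _ _ h

/-- The inner dilation multiplies the outer shift by `2^j`; `0 ≤ j` keeps the combined shift an
integer. -/
theorem dilTrans_dilTrans (i j k l : ℤ) (hj : 0 ≤ j) (f : L2R) :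
    dilTrans i k (dilTrans j l f) = dilTrans (i + j) (2 ^ j.toNat * k + l) f := by
  unfold dilTrans
  rw [affineIsometry_comp]
  have h1 : (2 : ℝ) ^ j * 2 ^ i = 2 ^ (i + j) := by rw [zpow_add₀ two_ne_zero, mul_comm]
  have h2 : (2 : ℝ) ^ j * k + l = ((2 ^ j.toNat * k + l : ℤ) : ℝ) := by
    push_cast
    congr 2
    rw [← zpow_natCast, Int.toNat_of_nonneg hj]
  congr 1
  simp only [h1, h2]

theorem dilTrans_surjective (j : ℤ) : Function.Surjective (dilTrans j 0) := by
  intro g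
  refine ⟨affineIsometry ((2 : ℝ) ^ (-j)) (by positivity) 0 g, ?_⟩
  unfold dilTrans
  rw [affineIsometry_comp]
  have h1 : (2 : ℝ) ^ (-j) * 2 ^ j = 1 := by
    rw [zpow_neg, inv_mul_cancel₀ (by positivity)]
  have h2 : (2 : ℝ) ^ (-j) * ((0 : ℤ) : ℝ) + 0 = 0 := by simp
  simp only [h1, h2]
  exact affineIsometry_one_zero g

theorem dilTrans_eq_comp (j k : ℤ) (f : L2R) : dilTrans j k f = dilTrans j 0 (dilTrans 0 k f) := by
  rw [dilTrans_dilTrans j 0 0 k le_rfl]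
  simp

end Affine

/-! ### Closed spans of dilated translates -/

section ShiftSpace

theorem shiftSpace_eq_span {f : ℕ → ℝ → ℂ} {F : ℕ → L2R} (s : Set ℕ)
    (h : ∀ q ∈ s, F q =ᵐ[volume] f q) (j : ℤ) :
    shiftSpace f s j =
      (Submodule.span ℂ {g | ∃ q ∈ s, ∃ k : ℤ, g = dilTrans j k (F q)}).topologicalClosure := by
  unfold shiftSpace
  congr 2
  ext g
  simp only [Set.mem_ofPred_eq]
  refine exists_congr fun q => and_congr_right fun hq => exists_congr fun k => ?_
  have := dilTrans_ae j k (h q hq)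
  constructor
  · intro hg
    exact Lp.ext (hg.trans this.symm)
  · rintro rfl
    exact this

theorem mem_orthogonal_shiftSpace {f : ℕ → ℝ → ℂ} {F : ℕ → L2R} {s : Set ℕ}
    (h : ∀ q ∈ s, F q =ᵐ[volume] f q) {j : ℤ} {g : L2R} :
    g ∈ (shiftSpace f s j)ᗮ ↔ ∀ q ∈ s, ∀ k : ℤ, inner ℂ (dilTrans j k (F q)) g = 0 := by
  rw [shiftSpace_eq_span s h, Submodule.orthogonal_closure]
  constructor
  · intro hg q hq k
    exact hg _ (Submodule.subset_span ⟨q, hq, k, rfl⟩)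
  · intro hg
    rw [← Submodule.span_singleton_le_iff_mem, ← Submodule.isOrtho_iff_le, Submodule.isOrtho_comm,
      Submodule.isOrtho_span]
    rintro _ ⟨q, hq, k, rfl⟩ _ rfl
    exact hg q hq k

theorem dilTrans_mem_shiftSpace {f : ℕ → ℝ → ℂ} {F : ℕ → L2R} {s : Set ℕ}
    (h : ∀ q ∈ s, F q =ᵐ[volume] f q) (j : ℤ) {q : ℕ} (hq : q ∈ s) (k : ℤ) :
    dilTrans j k (F q) ∈ shiftSpace f s j := by
  rw [shiftSpace_eq_span s h]
  exact Submodule.le_topologicalClosure _ (Submodule.subset_span ⟨q, hq, k, rfl⟩)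

theorem shiftSpace_le {f : ℕ → ℝ → ℂ} {F : ℕ → L2R} {s : Set ℕ}
    (h : ∀ q ∈ s, F q =ᵐ[volume] f q) {j : ℤ} {K : Submodule ℂ L2R}
    (hK : IsClosed (K : Set L2R)) (hF : ∀ q ∈ s, ∀ k : ℤ, dilTrans j k (F q) ∈ K) :
    shiftSpace f s j ≤ K := by
  rw [shiftSpace_eq_span s h]
  refine Submodule.topologicalClosure_minimal _ (Submodule.span_le.2 ?_) hK
  rintro _ ⟨q, hq, k, rfl⟩
  exact hF q hq k

theorem isClosed_shiftSpace (f : ℕ → ℝ → ℂ) (s : Set ℕ) (j : ℤ) :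
    IsClosed (shiftSpace f s j : Set L2R) :=
  Submodule.isClosed_topologicalClosure _

end ShiftSpace

/-! ### Quarks and quarklets as elements of `L₂(ℝ)` -/

section Quarks

theorem quark_eq_indicator (q : ℕ) :
    quark q = Set.indicator (Set.Ico (0 : ℝ) 1) (fun x => (x : ℂ) ^ q) := by
  ext x
  by_cases h : x ∈ Set.Ico (0 : ℝ) 1 <;> simp [quark, h]

theorem measurable_quark (q : ℕ) : Measurable (quark q) := by
  rw [quark_eq_indicator]
  exact Measurable.indicator (by fun_prop) measurableSet_Ico

theorem norm_quark_le (q : ℕ) (x : ℝ) :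
    ‖quark q x‖ ≤ Set.indicator (Set.Ico (0 : ℝ) 1) (fun _ => (1 : ℝ)) x := by
  rw [quark_eq_indicator, norm_indicator_eq_indicator_norm]
  refine Set.indicator_le_indicator' fun hx => ?_
  rw [norm_pow, Complex.norm_real, Real.norm_of_nonneg hx.1]
  exact pow_le_one₀ hx.1 hx.2.le

theorem memLp_quark (q : ℕ) (p : ENNReal) : MemLp (quark q) p volume := by
  refine (memLp_indicator_const p (measurableSet_Ico (a := (0 : ℝ)) (b := 1)) (1 : ℝ)
    (Or.inr (by simp))).of_le
    (measurable_quark q).aestronglyMeasurable (Filter.Eventually.of_forall fun x => ?_)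
  exact (norm_quark_le q x).trans (le_abs_self _)

/-- The Haar quark as an element of `L₂(ℝ)`. -/
noncomputable def quarkLp (q : ℕ) : L2R := (memLp_quark q 2).toLp (quark q)

theorem coeFn_quarkLp (q : ℕ) : quarkLp q =ᵐ[volume] quark q := MemLp.coeFn_toLp _

theorem waveletCoeff_support_finite (mt : ℕ) : (Function.support (waveletCoeff mt)).Finite := by
  refine Set.Finite.subset (((dualMask mt).coeff.support.finite_toSet).image fun k => 1 - k) ?_
  intro k hk
  refine ⟨1 - k, ?_, by ring⟩
  simp only [Function.mem_support, waveletCoeff] at hk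
  simpa using right_ne_zero_of_mul hk

/-- The coefficients of the wavelet as a finitely supported function. -/
noncomputable def waveletFinsupp (mt : ℕ) : ℤ →₀ ℝ :=
  Finsupp.ofSupportFinite (waveletCoeff mt) (waveletCoeff_support_finite mt)

theorem waveletFinsupp_apply (mt : ℕ) (k : ℤ) : waveletFinsupp mt k = waveletCoeff mt k := rfl

theorem quarklet_eq_sum (mt q : ℕ) (x : ℝ) :
    quarklet mt q x = ∑ k ∈ (waveletFinsupp mt).support,
      (waveletCoeff mt k : ℂ) * quark q (2 * x - k) := by
  refine finsum_eq_sum_of_support_subset _ fun k hk => ?_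
  have : waveletFinsupp mt k ≠ 0 := by
    intro h
    rw [waveletFinsupp_apply] at h
    simp [h] at hk
  simpa using this

/-- The Haar quarklet as an element of `L₂(ℝ)`. -/
noncomputable def quarkletLp (mt q : ℕ) : L2R :=
  ∑ k ∈ (waveletFinsupp mt).support, ((waveletCoeff mt k / √2 : ℝ) : ℂ) • dilTrans 1 k (quarkLp q)

theorem coeFn_quarkletLp (mt q : ℕ) : quarkletLp mt q =ᵐ[volume] quarklet mt q := by
  have h2 : ∀ᵐ x : ℝ, ∀ k : ℤ, (((waveletCoeff mt k / √2 : ℝ) : ℂ) • dilTrans 1 k (quarkLp q) : L2R) x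
      = (waveletCoeff mt k : ℂ) * quark q (2 * x - k) := by
    rw [ae_all_iff]
    intro k
    filter_upwards [Lp.coeFn_smul (((waveletCoeff mt k / √2 : ℝ) : ℂ)) (dilTrans 1 k (quarkLp q)),
      dilTrans_ae 1 k (coeFn_quarkLp q)] with x h1 h3
    rw [h1, Pi.smul_apply, h3, two_rpow_half, zpow_one, smul_eq_mul, ← mul_assoc,
      ← Complex.ofReal_mul, div_mul_cancel₀ _ (by positivity)]
  filter_upwards [Lp.coeFn_finsetSum (waveletFinsupp mt).support (fun k : ℤ =>
    (((waveletCoeff mt k / √2 : ℝ) : ℂ) • dilTrans 1 k (quarkLp q) : L2R)), h2] with x h1 h2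
  rw [quarkletLp, h1, Finset.sum_apply, quarklet_eq_sum]
  exact Finset.sum_congr rfl fun k _ => h2 k

theorem dilTrans_quarkletLp (mt q : ℕ) (j m : ℤ) :
    dilTrans j m (quarkletLp mt q) = ∑ k ∈ (waveletFinsupp mt).support,
      ((waveletCoeff mt k / √2 : ℝ) : ℂ) • dilTrans (j + 1) (2 * m + k) (quarkLp q) := by
  rw [quarkletLp, map_sum]
  refine Finset.sum_congr rfl fun k _ => ?_
  rw [LinearIsometry.map_smul, dilTrans_dilTrans j 1 m k zero_le_one]
  simp

end Quarks

/-! ### Transposed subdivision and a Liouville-type theorem -/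

section Subdivision

theorem injOn_sub_two_mul (k : ℤ) (s : Set ℤ) : Set.InjOn (fun l : ℤ => k - 2 * l) s :=
  fun a _ b _ h => by simpa using h

/-- One step of the dual of interpolatory subdivision, `δ_k ↦ ∑_l α_{k - 2l} δ_l`. -/
noncomputable def subdivStep (mt : ℕ) : (ℤ →₀ ℝ) →ₗ[ℝ] (ℤ →₀ ℝ) :=
  Finsupp.linearCombination ℝ fun k : ℤ => (interpMask mt).coeff.comapDomain (fun l => k - 2 * l)
    (injOn_sub_two_mul k _)

theorem subdivStep_apply (mt : ℕ) (c : ℤ →₀ ℝ) (l : ℤ) :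
    subdivStep mt c l = ∑ k ∈ c.support, c k * (interpMask mt).coeff (k - 2 * l) := by
  rw [subdivStep, Finsupp.linearCombination_apply, Finsupp.sum, Finsupp.finsetSum_apply]
  rfl

/-- The relation `hodd` says that subdividing the even samples `u'` reproduces `u`. By
transposition, a combination of values of `u` becomes one of values of `u'`. -/
theorem linearCombination_subdivStep (mt : ℕ) {u u' : ℤ → ℂ} (heven : ∀ l, u (2 * l) = u' l)
    (hodd : ∀ m : ℤ, ∑ n ∈ (interpMask mt).coeff.support,
      ((-1 : ℂ) ^ n * ((interpMask mt).coeff n : ℂ)) * u (2 * m + 1 + n) = 0) (c : ℤ →₀ ℝ) :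
    Finsupp.linearCombination ℝ u' (subdivStep mt c) = Finsupp.linearCombination ℝ u c := by
  have key : Finsupp.linearCombination ℝ u' ∘ₗ subdivStep mt = Finsupp.linearCombination ℝ u := by
    refine Finsupp.lhom_ext' fun k => LinearMap.ext_ring ?_
    simp only [LinearMap.comp_apply, Finsupp.lsingle_apply, subdivStep,
      Finsupp.linearCombination_single, one_smul]
    rw [Finsupp.linearCombination_apply, Finsupp.sum]
    simp only [Finsupp.comapDomain_apply, Finsupp.comapDomain_support, Complex.real_smul]
    rcases Int.even_or_odd' k with ⟨m, rfl | rfl⟩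
    · rw [Finset.sum_eq_single m]
      · have := interpMask_coeff_even mt 0
        simp only [mul_zero, if_true] at this
        simp [this, heven]
      · intro l _ hl
        rw [← mul_sub, interpMask_coeff_even, if_neg (sub_ne_zero.2 (Ne.symm hl))]
        simp
      · intro h
        have : (interpMask mt).coeff 0 = 0 := by simpa using h
        simp [this]
    · have h0 : (interpMask mt).coeff 0 = 1 := by simpa using interpMask_coeff_even mt 0
      have h := hodd m
      -- Among the even `n` only `n = 0` survives and the odd ones carry a minus sign, so `hodd`
      -- expresses `u (2m + 1)` as the mask-weighted sum of even samples.
      rw [← Finset.sum_filter_add_sum_filter_not _ (fun n : ℤ => Even n), Finset.sum_eq_single 0]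
        at h
      · rw [h0] at h
        simp only [zpow_zero, Complex.ofReal_one, mul_one, one_mul, add_zero] at h
        rw [eq_neg_of_add_eq_zero_left h, ← Finset.sum_neg_distrib]
        refine Finset.sum_nbij' (fun l => 2 * l - (2 * m + 1)) (fun n => (n + (2 * m + 1)) / 2)
          ?_ ?_ ?_ ?_ ?_
        · intro l hl
          have hl' : (interpMask mt).coeff (2 * m + 1 - 2 * l) ≠ 0 := by simpa using hl
          rw [← interpMask_coeff_neg, neg_sub] at hl'
          simp only [Finset.mem_filter, Finsupp.mem_support_iff]
          refine ⟨hl', ?_⟩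
          rw [Int.not_even_iff_odd]
          exact ⟨l - m - 1, by ring⟩
        · intro n hn
          simp only [Finset.mem_filter, Finsupp.mem_support_iff, Int.not_even_iff_odd] at hn
          obtain ⟨hn, a, rfl⟩ := hn
          have e : (2 * a + 1 + (2 * m + 1)) / 2 = a + m + 1 := by omega
          rw [← interpMask_coeff_neg] at hn
          simp only [Finset.mem_preimage, Finsupp.mem_support_iff, e]
          convert hn using 2
          ring
        · intro l _
          simp
        · intro n hn
          simp only [Finset.mem_filter, Int.not_even_iff_odd] at hn
          obtain ⟨hn, a, rfl⟩ := hn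
          omega
        · intro l _
          have e : Odd (2 * l - (2 * m + 1)) := ⟨l - m - 1, by ring⟩
          rw [e.neg_one_zpow, ← interpMask_coeff_neg, neg_sub, add_sub_cancel, heven]
          ring
      · intro n hn hn0
        obtain ⟨a, rfl⟩ := (Finset.mem_filter.1 hn).2
        rw [← two_mul, interpMask_coeff_even, if_neg (by rintro rfl; exact hn0 rfl)]
        simp
      · intro h
        simp [h0] at h
  exact LinearMap.congr_fun key c

theorem iterate_subdivStep_apply (mt J : ℕ) (x l : ℤ) :
    (subdivStep mt)^[J] (Finsupp.single x 1) l = subdivKernel mt J (x - 2 ^ J * l) := by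
  induction J generalizing l with
  | zero =>
    rw [subdivKernel_zero, Function.iterate_zero, id, Finsupp.single_apply]
    simp [sub_eq_zero]
  | succ J ih =>
    rw [Function.iterate_succ_apply', subdivStep_apply, subdivKernel_succ]
    have h1 : ∑ k ∈ ((subdivStep mt)^[J] (Finsupp.single x 1)).support,
        ((subdivStep mt)^[J] (Finsupp.single x 1)) k * (interpMask mt).coeff (k - 2 * l) =
        ∑ᶠ k : ℤ, ((subdivStep mt)^[J] (Finsupp.single x 1)) k *
          (interpMask mt).coeff (k - 2 * l) := by
      refine (finsum_eq_sum_of_support_subset _ fun k hk => ?_).symm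
      simpa using left_ne_zero_of_mul hk
    have h2 : ∑ m ∈ (interpMask mt).coeff.support,
        (interpMask mt).coeff m * subdivKernel mt J (x - 2 ^ (J + 1) * l - 2 ^ J * m) =
        ∑ᶠ m : ℤ, (interpMask mt).coeff m *
          subdivKernel mt J (x - 2 ^ (J + 1) * l - 2 ^ J * m) := by
      refine (finsum_eq_sum_of_support_subset _ fun k hk => ?_).symm
      simpa using left_ne_zero_of_mul hk
    rw [h1, h2, ← finsum_comp_equiv (Equiv.addRight (2 * l))]
    refine finsum_congr fun m => ?_
    rw [ih, Equiv.coe_addRight, mul_comm, add_sub_cancel_right]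
    congr 2
    ring

/-- If `|k| ≤ K` and `|k - 2l| ≤ K`, then `|l| ≤ K`: halving keeps the supports in one fixed
interval for all `J`. -/
theorem iterate_subdivStep_support (mt : ℕ) {K : ℤ}
    (hK : ∀ m, (interpMask mt).coeff m ≠ 0 → |m| ≤ K) {x : ℤ} (hx : |x| ≤ K) (J : ℕ) (l : ℤ)
    (hl : (subdivStep mt)^[J] (Finsupp.single x 1) l ≠ 0) : |l| ≤ K := by
  induction J generalizing l with
  | zero =>
    rw [Function.iterate_zero, id, Finsupp.single_apply_ne_zero] at hl
    rwa [hl.1]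
  | succ J ih =>
    rw [Function.iterate_succ_apply', subdivStep_apply] at hl
    obtain ⟨k, _, hk⟩ := Finset.exists_ne_zero_of_sum_ne_zero hl
    have h1 := abs_le.1 (ih k (left_ne_zero_of_mul hk))
    have h2 := abs_le.1 (hK _ (right_ne_zero_of_mul hk))
    rw [abs_le]
    omega

/-- A function of growth `o(√|y|)` with `G 0 = 0` that is reproduced by interpolatory subdivision on
all coarse dyadic grids vanishes on the grid. -/
theorem eq_zero_of_subdivision (mt : ℕ) {G : ℝ → ℂ} (h0 : G 0 = 0)
    (hgrowth : ∀ ε : ℝ, 0 < ε → ∃ C : ℝ, ∀ y : ℝ, ‖G y‖ ≤ C + ε * √|y|)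
    (hodd : ∀ (J : ℕ) (m : ℤ), ∑ n ∈ (interpMask mt).coeff.support,
      ((-1 : ℂ) ^ n * ((interpMask mt).coeff n : ℂ)) * G (2 ^ J * (2 * m + 1 + n)) = 0) (x : ℤ) :
    G x = 0 := by
  obtain ⟨K, hK, hxK⟩ : ∃ K : ℤ, (∀ m, (interpMask mt).coeff m ≠ 0 → |m| ≤ K) ∧ |x| ≤ K := by
    refine ⟨∑ m ∈ (interpMask mt).coeff.support, |m| + |x|, fun m hm => ?_, ?_⟩
    · have := Finset.single_le_sum (f := fun m : ℤ => |m|) (fun i _ => abs_nonneg i)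
        (Finsupp.mem_support_iff.2 hm)
      have h2 := abs_nonneg x
      exact this.trans (le_add_of_nonneg_right h2)
    · have : 0 ≤ ∑ m ∈ (interpMask mt).coeff.support, |m| :=
        Finset.sum_nonneg fun i _ => abs_nonneg i
      omega
  -- `G x` is a combination of values on the grid `2^J ℤ`, for every `J`.
  have hrep : ∀ J : ℕ, Finsupp.linearCombination ℝ (fun k : ℤ => G (2 ^ J * k))
      ((subdivStep mt)^[J] (Finsupp.single x 1)) = G x := by
    intro J
    induction J with
    | zero => simp
    | succ J ih =>
      rw [← ih, Function.iterate_succ_apply']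
      refine linearCombination_subdivStep mt (fun l => ?_) (fun m => ?_) _
      · congr 1
        push_cast
        ring
      · rw [← hodd J m]
        push_cast
        rfl
  set M : ℝ := (1 + (x : ℝ) ^ 2 / 2) * (Finset.Icc (-K) K).card with hM
  have hbound : ∀ ε : ℝ, 0 < ε → ‖G x‖ ≤ M * (ε * √K) := by
    intro ε hε
    obtain ⟨C, hC⟩ := hgrowth ε hε
    have hJ : ∀ J : ℕ, ‖G x‖ ≤ M * (C * √((1 / 2) ^ J) + ε * √K) := by
      intro J
      -- The choice `δ = 2^{-J/2}` balances the two terms of `abs_subdivKernel_le` and matches the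
      -- growth `√(2^J K)` of the samples.
      have hδ : 0 < √((1 / 2 : ℝ) ^ J) := by positivity
      have hδ2 : √((1 / 2 : ℝ) ^ J) ^ 2 = (1 / 2) ^ J := Real.sq_sqrt (by positivity)
      rw [← hrep J, Finsupp.linearCombination_apply, Finsupp.sum]
      refine (norm_sum_le _ _).trans ?_
      have hsub : ((subdivStep mt)^[J] (Finsupp.single x 1)).support ⊆ Finset.Icc (-K) K := by
        intro l hl
        rw [Finset.mem_Icc, ← abs_le]
        exact iterate_subdivStep_support mt hK hxK J l (Finsupp.mem_support_iff.1 hl)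
      refine (Finset.sum_le_sum_of_subset_of_nonneg hsub fun _ _ _ => norm_nonneg _).trans ?_
      have hterm : ∀ l ∈ Finset.Icc (-K) K,
          ‖((subdivStep mt)^[J] (Finsupp.single x 1)) l • G (2 ^ J * l)‖ ≤
          (1 + (x : ℝ) ^ 2 / 2) * (C * √((1 / 2) ^ J) + ε * √K) := by
        intro l hl
        rw [Finset.mem_Icc, ← abs_le] at hl
        have hG := hC (2 ^ J * l)
        have hprod : √((1 / 2 : ℝ) ^ J) * √|2 ^ J * (l : ℝ)| ≤ √K := by
          rw [← Real.sqrt_mul (by positivity)]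
          refine Real.sqrt_le_sqrt ?_
          rw [abs_mul, abs_of_pos (by positivity : (0 : ℝ) < 2 ^ J), ← mul_assoc, ← mul_pow]
          norm_num
          exact_mod_cast hl
        have hG2 : √((1 / 2 : ℝ) ^ J) * ‖G (2 ^ J * l)‖ ≤ C * √((1 / 2) ^ J) + ε * √K := by
          nlinarith [mul_le_mul_of_nonneg_left hG hδ.le]
        have hnn : 0 ≤ C * √((1 / 2) ^ J) + ε * √K := le_trans (by positivity) hG2
        by_cases hl0 : l = 0
        -- The kernel estimate excludes this index; `G 0 = 0` removes its term.
        · subst hl0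
          simp only [Int.cast_zero, mul_zero, h0, smul_zero, norm_zero]
          positivity
        · rw [norm_smul, iterate_subdivStep_apply, Real.norm_eq_abs]
          have hD := abs_subdivKernel_le mt J x l hl0 hδ
          have e : √((1 / 2 : ℝ) ^ J) + (x : ℝ) ^ 2 / (2 * √((1 / 2) ^ J)) * (1 / 2) ^ J =
              (1 + (x : ℝ) ^ 2 / 2) * √((1 / 2) ^ J) := by
            rw [← hδ2]
            field_simp
            rw [Real.sqrt_sq hδ.le]
            ring
          rw [e] at hD
          calc _ ≤ (1 + (x : ℝ) ^ 2 / 2) * √((1 / 2) ^ J) * ‖G (2 ^ J * l)‖ := by gcongr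
            _ ≤ _ := by rw [mul_assoc]; gcongr
      refine (Finset.sum_le_card_nsmul _ _ _ hterm).trans (le_of_eq ?_)
      rw [nsmul_eq_mul, hM]
      ring
    have hlim : Filter.Tendsto (fun J : ℕ => M * (C * √((1 / 2) ^ J) + ε * √K)) Filter.atTop
        (nhds (M * (C * √0 + ε * √K))) := by
      refine ((((Real.continuous_sqrt.tendsto 0).comp ?_).const_mul C).add_const _).const_mul M
      exact tendsto_pow_atTop_nhds_zero_of_lt_one (by norm_num) (by norm_num)
    have := ge_of_tendsto hlim (Filter.Eventually.of_forall hJ)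
    simpa using this
  have hlim : Filter.Tendsto (fun ε : ℝ => M * (ε * √K)) (nhdsWithin 0 (Set.Ioi 0))
      (nhds (M * (0 * √K))) := by
    refine Filter.Tendsto.mono_left (Continuous.tendsto ?_ 0) nhdsWithin_le_nhds
    fun_prop
  have := ge_of_tendsto hlim (Filter.eventually_of_mem self_mem_nhdsWithin hbound)
  simpa using this

end Subdivision

/-! ### Primitives of `L₂` functions and their growth -/

section Primitive

/-- The primitive of an `L₂` function that vanishes at `0`. -/
noncomputable def primitive (f : L2R) (a : ℝ) : ℂ := ∫ x in (0 : ℝ)..a, f x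

theorem locallyIntegrable_L2R (f : L2R) : LocallyIntegrable f volume :=
  (Lp.memLp f).locallyIntegrable one_le_two

theorem intervalIntegrable_L2R (f : L2R) (a b : ℝ) : IntervalIntegrable f volume a b := by
  rw [intervalIntegrable_iff]
  exact ((locallyIntegrable_L2R f).integrableOn_isCompact isCompact_uIcc).mono_set
    Set.uIoc_subset_uIcc

theorem continuous_primitive (f : L2R) : Continuous (primitive f) :=
  intervalIntegral.continuous_primitive (intervalIntegrable_L2R f) 0

theorem eq_zero_of_primitive_eq_zero {f : L2R} (h : ∀ a, primitive f a = 0) : f = 0 := by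
  rw [Lp.eq_zero_iff_ae_eq_zero]
  filter_upwards [_root_.LocallyIntegrable.ae_hasDerivAt_integral (locallyIntegrable_L2R f)] with x hx
  have h1 := hx 0
  have h2 : (fun b => ∫ y in (0 : ℝ)..b, f y) = fun _ => (0 : ℂ) := funext h
  rw [h2] at h1
  exact h1.unique (hasDerivAt_const x (0 : ℂ))

theorem inner_dilTrans_quarkLp_zero (f : L2R) (j k : ℤ) :
    inner ℂ (dilTrans j k (quarkLp 0)) f = ((√((2 : ℝ) ^ j) : ℝ) : ℂ) *
      (primitive f ((2 : ℝ) ^ (-j) * (k + 1)) - primitive f ((2 : ℝ) ^ (-j) * k)) := by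
  have hpos : (0 : ℝ) < 2 ^ j := by positivity
  have hle : (2 : ℝ) ^ (-j) * k ≤ (2 : ℝ) ^ (-j) * (k + 1) := by gcongr; linarith
  rw [primitive, primitive, intervalIntegral.integral_interval_sub_left
    (intervalIntegrable_L2R f _ _) (intervalIntegrable_L2R f _ _),
    intervalIntegral.integral_of_le hle, ← integral_Ico_eq_integral_Ioc, L2.inner_def,
    ← integral_const_mul, ← integral_indicator measurableSet_Ico]
  refine integral_congr_ae ?_
  filter_upwards [dilTrans_ae j k (coeFn_quarkLp 0)] with x hx
  rw [hx, two_rpow_half, quark_eq_indicator]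
  have hiff : (2 : ℝ) ^ j * x - k ∈ Set.Ico (0 : ℝ) 1 ↔
      x ∈ Set.Ico ((2 : ℝ) ^ (-j) * k) ((2 : ℝ) ^ (-j) * (k + 1)) := by
    rw [Set.mem_Ico, Set.mem_Ico, zpow_neg, inv_mul_le_iff₀ hpos, lt_inv_mul_iff₀ hpos]
    constructor <;> rintro ⟨h1, h2⟩ <;> constructor <;> linarith
  by_cases h : x ∈ Set.Ico ((2 : ℝ) ^ (-j) * k) ((2 : ℝ) ^ (-j) * (k + 1))
  · rw [Set.indicator_of_mem h, Set.indicator_of_mem (hiff.2 h)]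
    simp [RCLike.inner_apply, mul_comm]
  · rw [Set.indicator_of_notMem h, Set.indicator_of_notMem (mt hiff.1 h)]
    simp

theorem norm_setIntegral_L2R_le (f : L2R) {s : Set ℝ} (hs : MeasurableSet s)
    (hμ : volume s ≠ ⊤) : ‖∫ x in s, f x‖ ≤ √(volume.real s) * ‖f‖ := by
  rw [← L2.inner_indicatorConstLp_one hs hμ]
  refine (norm_inner_le_norm _ _).trans ?_
  gcongr
  rw [norm_indicatorConstLp (by simp) (by simp)]
  simp [Real.sqrt_eq_rpow]

theorem norm_primitive_le (f : L2R) (y : ℝ) : ‖primitive f y‖ ≤ √|y| * ‖f‖ := by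
  rw [primitive, intervalIntegral.norm_intervalIntegral_eq]
  refine (norm_setIntegral_L2R_le f measurableSet_uIoc (by simp [Set.uIoc])).trans (le_of_eq ?_)
  congr 2
  simp [Measure.real, Set.uIoc]
  rcases le_total 0 y with h | h <;> simp [h, abs_of_nonneg, abs_of_nonpos]

/-- Cauchy-Schwarz alone gives `O(√|y|)`. Approximating `f` within `ε` by a continuous compactly
supported `g`, whose primitive is bounded by its `L₁` norm, improves this to `o(√|y|)`. -/
theorem norm_primitive_growth (f : L2R) (ε : ℝ) (hε : 0 < ε) :
    ∃ C : ℝ, ∀ y : ℝ, ‖primitive f y‖ ≤ C + ε * √|y| := by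
  obtain ⟨g, hg1, hg2, hg3, hg4⟩ := (Lp.memLp f).exists_hasCompactSupport_eLpNorm_sub_le
    (by simp) (ε := ENNReal.ofReal ε) (by simpa using hε)
  have hint : Integrable g := hg3.integrable_of_hasCompactSupport hg1
  set G : L2R := hg4.toLp g with hG
  have hnorm : ‖f - G‖ ≤ ε := by
    rw [Lp.norm_def]
    refine ENNReal.toReal_le_of_le_ofReal hε.le (le_trans (le_of_eq ?_) hg2)
    refine eLpNorm_congr_ae ?_
    filter_upwards [Lp.coeFn_sub f G, hg4.coeFn_toLp] with x h1 h2
    rw [h1, Pi.sub_apply, Pi.sub_apply, h2]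
  refine ⟨∫ x, ‖g x‖, fun y => ?_⟩
  have hsplit : primitive f y = primitive G y + primitive (f - G) y := by
    rw [primitive, primitive, primitive, ← intervalIntegral.integral_add
      (intervalIntegrable_L2R G _ _) (intervalIntegrable_L2R _ _ _)]
    refine intervalIntegral.integral_congr_ae ?_
    filter_upwards [Lp.coeFn_sub f G] with x hx _
    rw [hx]
    simp
  rw [hsplit]
  refine (norm_add_le _ _).trans (add_le_add ?_ ?_)
  · have : primitive G y = ∫ x in (0 : ℝ)..y, g x :=
      intervalIntegral.integral_congr_ae (by filter_upwards [hg4.coeFn_toLp] with x hx _ using hx)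
    rw [this, intervalIntegral.norm_intervalIntegral_eq]
    refine (norm_integral_le_integral_norm _).trans ?_
    exact setIntegral_le_integral hint.norm (Filter.Eventually.of_forall fun x => norm_nonneg _)
  · refine (norm_primitive_le _ _).trans ?_
    rw [mul_comm]
    gcongr

end Primitive

/-! ### Orthogonality to the wavelets forces a function to vanish -/

section Density

theorem waveletCoeff_sub (mt : ℕ) (k : ℤ) :
    waveletCoeff mt k - waveletCoeff mt (k + 1) = 2 * ((-1) ^ k * (interpMask mt).coeff k) := by
  rw [← interpMask_coeff_neg, interpMask_coeff, waveletCoeff, waveletCoeff,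
    zpow_add_one₀ (by norm_num)]
  rw [show 1 - (k + 1) = -k by ring, show 1 - k = -k + 1 by ring]
  ring

/-- Summation by parts: differences of the wavelet coefficients are, up to sign and the factor 2,
the interpolatory mask. -/
theorem sum_interpMask_of_sum_waveletCoeff (mt : ℕ) (u : ℤ → ℂ)
    (h : ∑ k ∈ (waveletFinsupp mt).support, (waveletCoeff mt k : ℂ) * (u (k + 1) - u k) = 0) :
    ∑ n ∈ (interpMask mt).coeff.support,
      ((-1 : ℂ) ^ n * ((interpMask mt).coeff n : ℂ)) * u (n + 1) = 0 := by
  have hfin := waveletCoeff_support_finite mt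
  have hf1 : (Function.support fun k : ℤ => (waveletCoeff mt k : ℂ) * u (k + 1)).Finite :=
    hfin.subset fun k hk => by simpa using left_ne_zero_of_mul hk
  have hf2 : (Function.support fun k : ℤ => (waveletCoeff mt k : ℂ) * u k).Finite :=
    hfin.subset fun k hk => by simpa using left_ne_zero_of_mul hk
  have hf3 : (Function.support fun k : ℤ => (waveletCoeff mt (k + 1) : ℂ) * u (k + 1)).Finite :=
    hf2.preimage (f := fun k : ℤ => k + 1) (fun a _ b _ h => by simpa using h)
  have h1 : ∑ k ∈ (waveletFinsupp mt).support, (waveletCoeff mt k : ℂ) * (u (k + 1) - u k) =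
      ∑ᶠ k : ℤ, (waveletCoeff mt k : ℂ) * (u (k + 1) - u k) := by
    refine (finsum_eq_sum_of_support_subset _ fun k hk => ?_).symm
    have := left_ne_zero_of_mul hk
    simpa [waveletFinsupp_apply] using this
  have h2 : ∑ n ∈ (interpMask mt).coeff.support,
      ((-1 : ℂ) ^ n * ((interpMask mt).coeff n : ℂ)) * u (n + 1) =
      ∑ᶠ n : ℤ, ((-1 : ℂ) ^ n * ((interpMask mt).coeff n : ℂ)) * u (n + 1) := by
    refine (finsum_eq_sum_of_support_subset _ fun k hk => ?_).symm
    have := right_ne_zero_of_mul (left_ne_zero_of_mul hk)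
    simpa using this
  rw [h1] at h
  simp_rw [mul_sub] at h
  rw [finsum_sub_distrib hf1 hf2,
    ← finsum_comp_equiv (f := fun k : ℤ => (waveletCoeff mt k : ℂ) * u k) (Equiv.addRight (1 : ℤ))]
    at h
  simp only [Equiv.coe_addRight] at h
  rw [← finsum_sub_distrib hf1 hf3] at h
  rw [h2, ← mul_right_inj' (two_ne_zero (α := ℂ)), mul_zero, ← h, ← smul_eq_mul, smul_finsum]
  refine finsum_congr fun k => ?_
  have := congrArg (fun t : ℝ => (t : ℂ)) (waveletCoeff_sub mt k)
  push_cast at this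
  rw [← sub_mul, this, smul_eq_mul]
  ring

/-- Pairing `f` with a Haar function gives an increment of the primitive, so orthogonality to a
wavelet becomes a relation among its samples on the grid of level `j + 1`. -/
theorem primitive_relation {mt : ℕ} {f : L2R} {j : ℤ}
    (hf : ∀ k : ℤ, inner ℂ (dilTrans j k (quarkletLp mt 0)) f = 0) (m : ℤ) :
    ∑ n ∈ (interpMask mt).coeff.support, ((-1 : ℂ) ^ n * ((interpMask mt).coeff n : ℂ)) *
      primitive f ((2 : ℝ) ^ (-(j + 1)) * (2 * m + 1 + n)) = 0 := by
  have h := hf m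
  rw [dilTrans_quarkletLp, sum_inner] at h
  simp_rw [inner_smul_left, inner_dilTrans_quarkLp_zero, Complex.conj_ofReal, Complex.ofReal_div,
    div_mul_eq_mul_div, mul_left_comm _ ((√((2 : ℝ) ^ (j + 1)) : ℝ) : ℂ), mul_div_assoc] at h
  rw [← Finset.mul_sum] at h
  have h' := (mul_eq_zero.1 h).resolve_left
    (Complex.ofReal_ne_zero.2 (by positivity))
  simp_rw [← mul_div_assoc] at h'
  rw [← Finset.sum_div, div_eq_zero_iff] at h'
  have h'' := h'.resolve_right (Complex.ofReal_ne_zero.2 (by positivity))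
  have := sum_interpMask_of_sum_waveletCoeff mt
    (fun n => primitive f ((2 : ℝ) ^ (-(j + 1)) * (2 * m + n))) (by
      rw [← h'']
      refine Finset.sum_congr rfl fun k _ => ?_
      push_cast
      ring_nf)
  rw [← this]
  refine Finset.sum_congr rfl fun k _ => ?_
  push_cast
  ring_nf

theorem primitive_eq_zero_of_dyadic {f : L2R}
    (h : ∀ (J : ℕ) (x : ℤ), primitive f ((2 : ℝ) ^ (-(J : ℤ)) * x) = 0) : f = 0 := by
  refine eq_zero_of_primitive_eq_zero fun a => ?_
  have hlim : Filter.Tendsto (fun J : ℕ => (2 : ℝ) ^ (-(J : ℤ)) * (⌊(2 : ℝ) ^ J * a⌋ : ℤ))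
      Filter.atTop (nhds a) := by
    have h0 : Filter.Tendsto (fun J : ℕ => a - (1 / 2 : ℝ) ^ J) Filter.atTop (nhds (a - 0)) :=
      tendsto_const_nhds.sub
        (tendsto_pow_atTop_nhds_zero_of_lt_one (by norm_num) (by norm_num))
    rw [sub_zero] at h0
    refine tendsto_of_tendsto_of_tendsto_of_le_of_le h0 tendsto_const_nhds (fun J => ?_)
      (fun J => ?_)
    · have h1 := (Int.sub_one_lt_floor ((2 : ℝ) ^ J * a)).le
      simp only [zpow_neg, zpow_natCast]
      rw [one_div, inv_pow, le_inv_mul_iff₀ (by positivity), mul_sub,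
        mul_inv_cancel₀ (by positivity)]
      exact h1
    · simp only [zpow_neg, zpow_natCast]
      rw [inv_mul_le_iff₀ (by positivity)]
      exact Int.floor_le _
  have h1 := ((continuous_primitive f).tendsto a).comp hlim
  simp only [Function.comp_def, h] at h1
  exact tendsto_nhds_unique h1 tendsto_const_nhds

theorem eq_zero_of_orthogonal_wavelets {mt : ℕ} {f : L2R}
    (hf : ∀ j k : ℤ, inner ℂ (dilTrans j k (quarkletLp mt 0)) f = 0) : f = 0 := by
  refine primitive_eq_zero_of_dyadic fun J x => ?_
  refine eq_zero_of_subdivision mt (G := fun y => primitive f ((2 : ℝ) ^ (-(J : ℤ)) * y))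
    (by simp [primitive]) (fun ε hε => ?_) (fun I m => ?_) x
  · have hs : 0 < √((2 : ℝ) ^ (-(J : ℤ))) := by positivity
    obtain ⟨C, hC⟩ := norm_primitive_growth f (ε / √((2 : ℝ) ^ (-(J : ℤ)))) (by positivity)
    refine ⟨C, fun y => (hC _).trans (le_of_eq ?_)⟩
    rw [abs_mul, abs_of_pos (by positivity : (0 : ℝ) < 2 ^ (-(J : ℤ))),
      Real.sqrt_mul (by positivity)]
    field_simp
  -- The level is chosen so that `2^{-(j+1)} = 2^{-J} 2^I`; arbitrarily coarse grids require
  -- negative `j`.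
  · have := primitive_relation (mt := mt) (f := f) (j := J - I - 1) (hf _) m
    rw [← this]
    refine Finset.sum_congr rfl fun n _ => ?_
    congr 2
    rw [← mul_assoc, ← zpow_natCast, ← zpow_add₀ two_ne_zero]
    congr 2
    ring

/-- Orthogonality to the translates of `φ_0` makes the primitive vanish on the integers. Each
wavelet level then carries the zeros to the next finer dyadic grid, so no growth argument is needed.
-/
theorem eq_zero_of_orthogonal_quark_wavelets {mt : ℕ} {f : L2R}
    (h0 : ∀ k : ℤ, inner ℂ (dilTrans 0 k (quarkLp 0)) f = 0)
    (hf : ∀ (j : ℕ) (k : ℤ), inner ℂ (dilTrans j k (quarkletLp mt 0)) f = 0) : f = 0 := by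
  refine primitive_eq_zero_of_dyadic fun J => ?_
  induction J with
  | zero =>
    intro x
    have hstep : ∀ k : ℤ, primitive f (k + 1) = primitive f k := by
      intro k
      have := h0 k
      rw [inner_dilTrans_quarkLp_zero] at this
      simpa [sub_eq_zero] using this
    have hz : primitive f 0 = 0 := by simp [primitive]
    induction x using Int.induction_on with
    | zero => simp [hz]
    | succ n ih =>
      have := hstep n
      simp only [Nat.cast_zero, neg_zero, zpow_zero, one_mul] at ih ⊢
      push_cast at this ih ⊢
      rw [this, ih]
    | pred n ih =>
      have := hstep (-n - 1)
      simp only [Nat.cast_zero, neg_zero, zpow_zero, one_mul] at ih ⊢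
      push_cast at this ih ⊢
      rw [← this, ← ih]
      ring_nf
  | succ J ih =>
    intro x
    have hodd := primitive_relation (hf J)
    have heven : ∀ l : ℤ, primitive f ((2 : ℝ) ^ (-((J : ℤ) + 1)) * (2 * l : ℤ)) = 0 := by
      intro l
      rw [← ih l]
      congr 1
      rw [neg_add, zpow_add₀ two_ne_zero]
      push_cast
      norm_num
      ring
    have := linearCombination_subdivStep mt
      (u := fun n : ℤ => primitive f ((2 : ℝ) ^ (-((J : ℤ) + 1)) * n)) (u' := fun _ => 0)
      heven (fun m => by
        rw [← hodd m]
        refine Finset.sum_congr rfl fun n _ => ?_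
        push_cast
        rfl) (Finsupp.single x 1)
    simp only [Finsupp.linearCombination_single, one_smul] at this
    push_cast
    rw [← this]
    simp [Finsupp.linearCombination_apply]

end Density

/-! ### Coefficient functionals on `V_{p,j}` -/

section CoefficientFunctionals

/-- A vanishing combination is a polynomial that is zero a.e. on `(0, 1)`, hence one with infinitely
many roots. -/
theorem linearIndependent_quarkLp : LinearIndependent ℂ quarkLp := by
  rw [linearIndependent_iff']
  intro s g hg i hi
  set P : Polynomial ℂ := ∑ i ∈ s, Polynomial.monomial i (g i) with hP
  have hae : ∀ᵐ x : ℝ, x ∈ Set.Ioo (0 : ℝ) 1 → P.eval (x : ℂ) = 0 := by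
    have h1 := Lp.coeFn_finsetSum s fun i => g i • quarkLp i
    have h2 : ∀ᵐ x : ℝ, ∀ i, (g i • quarkLp i : L2R) x = g i * quark i x := by
      rw [ae_all_iff]
      intro i
      filter_upwards [Lp.coeFn_smul (g i) (quarkLp i), coeFn_quarkLp i] with x h3 h4
      rw [h3, Pi.smul_apply, h4, smul_eq_mul]
    rw [hg] at h1
    filter_upwards [h1, h2, Lp.coeFn_zero ℂ 2 (volume : Measure ℝ)] with x h1 h2 h0 hx
    rw [h0, Finset.sum_apply] at h1
    rw [hP, Polynomial.eval_finsetSum, ← Pi.zero_apply (M := fun _ => ℂ) x, h1]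
    refine Finset.sum_congr rfl fun i _ => ?_
    rw [h2, quark_eq_indicator, Set.indicator_of_mem (Set.Ioo_subset_Ico_self hx),
      Polynomial.eval_monomial]
  have hinf : {z : ℂ | P.IsRoot z}.Infinite := by
    have hI : {x : ℝ | x ∈ Set.Ioo (0 : ℝ) 1 ∧ P.eval (x : ℂ) = 0}.Infinite := by
      intro hfin
      have hnull := hfin.measure_zero (volume : Measure ℝ)
      have : volume (Set.Ioo (0 : ℝ) 1) = 0 := by
        refine measure_mono_null_ae ?_ hnull
        filter_upwards [hae] with x hx hxI using ⟨hxI, hx hxI⟩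
      simp at this
    refine (hI.image (f := fun x : ℝ => (x : ℂ)) Complex.ofReal_injective.injOn).mono ?_
    rintro _ ⟨x, hx, rfl⟩
    exact hx.2
  have hP0 := Polynomial.eq_zero_of_infinite_isRoot P hinf
  have := congrArg (fun Q : Polynomial ℂ => Q.coeff i) hP0
  simpa [hP, Polynomial.finsetSum_coeff, Polynomial.coeff_monomial, hi] using this

/-- Continuous coordinate functionals of a finite linearly independent family in a Hilbert space,
vanishing on the orthogonal complement of its span. -/
theorem exists_coordinate_functionals {ι H : Type*} [Fintype ι] [DecidableEq ι]
    [NormedAddCommGroup H] [InnerProductSpace ℂ H] {v : ι → H} (hv : LinearIndependent ℂ v) :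
    ∃ L : ι → H →L[ℂ] ℂ, (∀ i j, L i (v j) = if i = j then 1 else 0) ∧
      ∀ g, (∀ i, L i g = 0) ↔ ∀ i, inner ℂ (v i) g = 0 := by
  set E := Submodule.span ℂ (Set.range v) with hE
  let b : Module.Basis ι ℂ E := Module.Basis.span hv
  have : FiniteDimensional ℂ E := Module.Finite.of_basis b
  have hb : ∀ i, (b i : H) = v i := fun i =>
    congrArg Subtype.val (Module.Basis.span_apply hv i)
  refine ⟨fun i => (LinearMap.toContinuousLinearMap (b.coord i)) ∘L E.orthogonalProjectionOnto,
    fun i j => ?_, fun g => ?_⟩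
  · rw [ContinuousLinearMap.comp_apply, ← hb, Submodule.orthogonalProjectionOnto_mem_subspace_eq_self]
    simp [Finsupp.single_apply, eq_comm]
  · have h1 : (∀ i, ((LinearMap.toContinuousLinearMap (b.coord i)) ∘L
        E.orthogonalProjectionOnto) g = 0) ↔ E.orthogonalProjectionOnto g = 0 := by
      simp only [ContinuousLinearMap.comp_apply, LinearMap.coe_toContinuousLinearMap']
      exact b.forall_coord_eq_zero_iff
    rw [h1, Submodule.orthogonalProjectionOnto_eq_zero_iff]
    constructor
    · intro h i
      exact h _ (Submodule.subset_span ⟨i, rfl⟩)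
    · intro h
      rw [← Submodule.span_singleton_le_iff_mem, ← Submodule.isOrtho_iff_le,
        Submodule.isOrtho_comm, Submodule.isOrtho_span]
      rintro _ ⟨i, rfl⟩ _ rfl
      exact h i

theorem linearIndependent_quarkLp_fin (p : ℕ) :
    LinearIndependent ℂ fun q : Fin (p + 1) => quarkLp q :=
  linearIndependent_quarkLp.comp _ Fin.val_injective

/-- The functional that reads off the coefficient of `2^{j/2} φ_q(2^j · - k)` on `V_{p,j}`. -/
noncomputable def quarkCoeff (p : ℕ) (j k : ℤ) (q : Fin (p + 1)) : L2R →L[ℂ] ℂ :=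
  (exists_coordinate_functionals (linearIndependent_quarkLp_fin p)).choose q ∘L
    ContinuousLinearMap.adjoint (dilTrans j k).toContinuousLinearMap

theorem inner_dilTrans_quarkLp_of_ne {j k k' : ℤ} (h : k ≠ k') (q q' : ℕ) :
    inner ℂ (dilTrans j k (quarkLp q)) (dilTrans j k' (quarkLp q')) = 0 := by
  rw [L2.inner_def]
  refine integral_eq_zero_of_ae ?_
  filter_upwards [dilTrans_ae j k (coeFn_quarkLp q), dilTrans_ae j k' (coeFn_quarkLp q')]
    with x h1 h2
  rw [h1, h2, quark_eq_indicator, quark_eq_indicator]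
  by_cases h3 : (2 : ℝ) ^ j * x - k ∈ Set.Ico (0 : ℝ) 1
  · by_cases h4 : (2 : ℝ) ^ j * x - k' ∈ Set.Ico (0 : ℝ) 1
    · exfalso
      apply h
      have e1 : ⌊(2 : ℝ) ^ j * x⌋ = k := by
        rw [Int.floor_eq_iff]; constructor <;> linarith [h3.1, h3.2]
      have e2 : ⌊(2 : ℝ) ^ j * x⌋ = k' := by
        rw [Int.floor_eq_iff]; constructor <;> linarith [h4.1, h4.2]
      rw [← e1, e2]
    · simp [Set.indicator_of_notMem h4]
  · simp [Set.indicator_of_notMem h3]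

theorem quarkCoeff_dilTrans (p : ℕ) (j k k' : ℤ) (q : Fin (p + 1)) {q' : ℕ} (hq' : q' ≤ p) :
    quarkCoeff p j k q (dilTrans j k' (quarkLp q')) = if k = k' ∧ (q : ℕ) = q' then 1 else 0 := by
  obtain ⟨h1, h2⟩ := (exists_coordinate_functionals (linearIndependent_quarkLp_fin p)).choose_spec
  rw [quarkCoeff, ContinuousLinearMap.comp_apply]
  by_cases hk : k = k'
  · subst hk
    have hU : ContinuousLinearMap.adjoint (dilTrans j k).toContinuousLinearMap
        (dilTrans j k (quarkLp q')) = quarkLp q' := by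
      refine ext_inner_left ℂ fun v => ?_
      rw [ContinuousLinearMap.adjoint_inner_right]
      exact (dilTrans j k).inner_map_map _ _
    rw [hU, h1 q ⟨q', Nat.lt_succ_of_le hq'⟩]
    simp [Fin.ext_iff]
  · rw [if_neg (fun h => hk h.1)]
    refine (h2 _).2 (fun i => ?_) q
    rw [ContinuousLinearMap.adjoint_inner_right]
    exact inner_dilTrans_quarkLp_of_ne hk _ _

theorem inner_eq_zero_of_quarkCoeff_eq_zero {p : ℕ} {j k : ℤ} {f : L2R}
    (h : ∀ q, quarkCoeff p j k q f = 0) {q : ℕ} (hq : q ≤ p) :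
    inner ℂ (dilTrans j k (quarkLp q)) f = 0 := by
  obtain ⟨h1, h2⟩ := (exists_coordinate_functionals (linearIndependent_quarkLp_fin p)).choose_spec
  have := (h2 _).1 h ⟨q, Nat.lt_succ_of_le hq⟩
  exact (ContinuousLinearMap.adjoint_inner_right (dilTrans j k).toContinuousLinearMap
    (quarkLp q) f).symm.trans this

/-- Joint vanishing of the functionals amounts to orthogonality to all generators, so `f` lies in
`V_{p,j}` and in its orthogonal complement. -/
theorem eq_zero_of_mem_spaceV {p : ℕ} {j : ℤ} {f : L2R} (hf : f ∈ spaceV p j)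
    (h : ∀ k q, quarkCoeff p j k q f = 0) : f = 0 := by
  have h1 : f ∈ (spaceV p j)ᗮ :=
    (mem_orthogonal_shiftSpace (F := quarkLp) fun q _ => coeFn_quarkLp q).2 fun q hq k =>
      inner_eq_zero_of_quarkCoeff_eq_zero (h k) hq
  exact inner_self_eq_zero.1 (h1 f hf)

/-- Continuity extends coefficient identities from the generators to the closed span. -/
theorem eqOn_shiftSpace {f : ℕ → ℝ → ℂ} {F : ℕ → L2R} {s : Set ℕ}
    (h : ∀ q ∈ s, F q =ᵐ[volume] f q) {j : ℤ} {φ ψ : L2R →L[ℂ] ℂ}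
    (hF : ∀ q ∈ s, ∀ k : ℤ, φ (dilTrans j k (F q)) = ψ (dilTrans j k (F q))) {g : L2R}
    (hg : g ∈ shiftSpace f s j) : φ g = ψ g := by
  have := shiftSpace_le h (j := j) (K := (φ - ψ).ker) (φ - ψ).isClosed_ker
    (fun q hq k => by simp [hF q hq k]) hg
  simpa [sub_eq_zero] using this

end CoefficientFunctionals

/-! ### Refinement of the quarks -/

section Refinement

/-- Write `x^q = 2^{-q} (2x)^q`; on the right half of the interval expand `(2x)^q = ((2x - 1) +
1)^q`. -/
theorem quark_refinement (q : ℕ) (x : ℝ) :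
    quark q x = (1 / 2 : ℂ) ^ q * (quark q (2 * x - (0 : ℤ)) +
      ∑ l ∈ Finset.range (q + 1), (q.choose l : ℂ) * quark l (2 * x - (1 : ℤ))) := by
  have hpow : (x : ℂ) ^ q = (1 / 2 : ℂ) ^ q * (2 * x) ^ q := by rw [← mul_pow]; ring_nf
  simp only [quark_eq_indicator, Int.cast_zero, Int.cast_one, sub_zero]
  by_cases h1 : 2 * x ∈ Set.Ico (0 : ℝ) 1
  · have h2 : 2 * x - 1 ∉ Set.Ico (0 : ℝ) 1 := fun h => by linarith [h.1, h1.2]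
    have h3 : x ∈ Set.Ico (0 : ℝ) 1 := ⟨by linarith [h1.1], by linarith [h1.1, h1.2]⟩
    simp only [Set.indicator_of_mem h1, Set.indicator_of_notMem h2, Set.indicator_of_mem h3]
    rw [hpow]
    simp
  · by_cases h2 : 2 * x - 1 ∈ Set.Ico (0 : ℝ) 1
    · have h3 : x ∈ Set.Ico (0 : ℝ) 1 := ⟨by linarith [h2.1], by linarith [h2.2]⟩
      simp only [Set.indicator_of_notMem h1, Set.indicator_of_mem h2, Set.indicator_of_mem h3]
      rw [hpow, zero_add]
      congr 1
      have := add_pow ((2 : ℂ) * x - 1) 1 q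
      rw [sub_add_cancel] at this
      rw [this]
      refine Finset.sum_congr rfl fun l _ => ?_
      push_cast
      rw [one_pow]
      ring
    · have h3 : x ∉ Set.Ico (0 : ℝ) 1 := by
        intro h
        rcases lt_or_ge (2 * x) 1 with h4 | h4
        · exact h1 ⟨by linarith [h.1], h4⟩
        · exact h2 ⟨by linarith, by linarith [h.2]⟩
      simp only [Set.indicator_of_notMem h1, Set.indicator_of_notMem h2,
        Set.indicator_of_notMem h3]
      simp

theorem quarkLp_refinement (q : ℕ) :
    quarkLp q = (((√2 : ℝ) : ℂ)⁻¹ * (1 / 2 : ℂ) ^ q) • (dilTrans 1 0 (quarkLp q) +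
      ∑ l ∈ Finset.range (q + 1), (q.choose l : ℂ) • dilTrans 1 1 (quarkLp l)) := by
  refine Lp.ext ?_
  have h1 : ∀ᵐ x : ℝ, ∀ k : ℤ, ∀ l, dilTrans 1 k (quarkLp l) x = ((√2 : ℝ) : ℂ) *
      quark l (2 * x - k) := by
    simp_rw [ae_all_iff]
    intro k l
    filter_upwards [dilTrans_ae 1 k (coeFn_quarkLp l)] with x hx
    rw [hx, two_rpow_half, zpow_one]
  have h2 : ∀ᵐ x : ℝ, ∀ l, ((q.choose l : ℂ) • dilTrans 1 1 (quarkLp l) : L2R) x =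
      (q.choose l : ℂ) * dilTrans 1 1 (quarkLp l) x := by
    rw [ae_all_iff]
    intro l
    filter_upwards [Lp.coeFn_smul (q.choose l : ℂ) (dilTrans 1 1 (quarkLp l))] with x hx
    rw [hx, Pi.smul_apply, smul_eq_mul]
  filter_upwards [coeFn_quarkLp q, h1, h2, Lp.coeFn_finsetSum (Finset.range (q + 1))
      fun l => ((q.choose l : ℂ) • dilTrans 1 1 (quarkLp l) : L2R),
    Lp.coeFn_add (dilTrans 1 0 (quarkLp q))
      (∑ l ∈ Finset.range (q + 1), (q.choose l : ℂ) • dilTrans 1 1 (quarkLp l)),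
    Lp.coeFn_smul (((√2 : ℝ) : ℂ)⁻¹ * (1 / 2 : ℂ) ^ q) (dilTrans 1 0 (quarkLp q) +
      ∑ l ∈ Finset.range (q + 1), (q.choose l : ℂ) • dilTrans 1 1 (quarkLp l))]
    with x h0 h1 h2 h3 h4 h5
  have hs : ((√2 : ℝ) : ℂ) ≠ 0 := Complex.ofReal_ne_zero.2 (by positivity)
  rw [h0, h5, Pi.smul_apply, h4, Pi.add_apply, h3, Finset.sum_apply]
  simp_rw [h2, h1]
  rw [quark_refinement]
  simp_rw [mul_left_comm _ ((√2 : ℝ) : ℂ)]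
  rw [← Finset.mul_sum, ← mul_add, smul_eq_mul]
  field_simp

theorem dilTrans_quarkLp_refinement (j k : ℤ) (q : ℕ) :
    dilTrans j k (quarkLp q) = (((√2 : ℝ) : ℂ)⁻¹ * (1 / 2 : ℂ) ^ q) •
      (dilTrans (j + 1) (2 * k) (quarkLp q) +
      ∑ l ∈ Finset.range (q + 1), (q.choose l : ℂ) • dilTrans (j + 1) (2 * k + 1) (quarkLp l)) := by
  conv_lhs => rw [quarkLp_refinement]
  simp [dilTrans_dilTrans]

theorem spaceV_le_succ (p : ℕ) (j : ℤ) : spaceV p j ≤ spaceV p (j + 1) := by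
  have hmem : ∀ l ≤ p, ∀ k : ℤ, dilTrans (j + 1) k (quarkLp l) ∈ spaceV p (j + 1) :=
    fun l hl k => dilTrans_mem_shiftSpace (fun q _ => coeFn_quarkLp q) _ (Set.mem_Iic.2 hl) k
  refine shiftSpace_le (fun q _ => coeFn_quarkLp q) (isClosed_shiftSpace quark _ _)
    fun q hq k => ?_
  rw [dilTrans_quarkLp_refinement]
  refine Submodule.smul_mem _ _ (Submodule.add_mem _ (hmem q hq _) ?_)
  refine Submodule.sum_mem _ fun l hl => Submodule.smul_mem _ _ (hmem l ?_ _)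
  exact (Nat.lt_succ_iff.1 (Finset.mem_range.1 hl)).trans hq

theorem spaceV_mono (p : ℕ) : Monotone (spaceV p) :=
  monotone_int_of_le_succ (spaceV_le_succ p)

theorem spaceW_le_spaceV (mt p : ℕ) (j : ℤ) : spaceW mt p j ≤ spaceV p (j + 1) := by
  refine shiftSpace_le (fun q _ => coeFn_quarkletLp mt q) (isClosed_shiftSpace _ _ _)
    fun q hq k => ?_
  rw [dilTrans_quarkletLp]
  exact Submodule.sum_mem _ fun l _ => Submodule.smul_mem _ _
    (dilTrans_mem_shiftSpace (fun q _ => coeFn_quarkLp q) _ hq _)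

theorem quarkCoeff_even_of_mem_spaceV {p : ℕ} {j : ℤ} {f : L2R} (hf : f ∈ spaceV p j) (k : ℤ)
    (q : Fin (p + 1)) :
    quarkCoeff p (j + 1) (2 * k) q f =
      (((√2 : ℝ) : ℂ)⁻¹ * (1 / 2 : ℂ) ^ (q : ℕ)) * quarkCoeff p j k q f := by
  refine eqOn_shiftSpace (φ := quarkCoeff p (j + 1) (2 * k) q)
    (ψ := (((√2 : ℝ) : ℂ)⁻¹ * (1 / 2 : ℂ) ^ (q : ℕ)) • quarkCoeff p j k q)
    (fun q _ => coeFn_quarkLp q) (fun q' hq' k' => ?_) hf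
  have hle : ∀ l ∈ Finset.range (q' + 1), l ≤ p := fun l hl =>
    (Nat.lt_succ_iff.1 (Finset.mem_range.1 hl)).trans hq'
  conv_lhs => rw [dilTrans_quarkLp_refinement]
  rw [map_smul, map_add, map_sum, _root_.smul_apply, quarkCoeff_dilTrans _ _ _ _ _ hq',
    quarkCoeff_dilTrans _ _ _ _ _ hq', Finset.sum_eq_zero, add_zero]
  · by_cases hk : k = k'
    · by_cases hq : (q : ℕ) = q'
      · simp [hk, hq]
      · simp [hq]
    · simp [hk]
  · intro l hl
    rw [map_smul, quarkCoeff_dilTrans _ _ _ _ _ (hle l hl), if_neg (by omega), smul_zero]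

/-- The matrix is triangular, as `binom(r, q) = 0` for `r < q`, and its diagonal agrees with the
factor for even indices. -/
theorem quarkCoeff_odd_of_mem_spaceV {p : ℕ} {j : ℤ} {f : L2R} (hf : f ∈ spaceV p j) (k : ℤ)
    (q : Fin (p + 1)) :
    quarkCoeff p (j + 1) (2 * k + 1) q f =
      ∑ r : Fin (p + 1), (((√2 : ℝ) : ℂ)⁻¹ * (1 / 2 : ℂ) ^ (r : ℕ) * ((r : ℕ).choose q : ℂ)) *
        quarkCoeff p j k r f := by
  have key := eqOn_shiftSpace (φ := quarkCoeff p (j + 1) (2 * k + 1) q)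
    (ψ := ∑ r : Fin (p + 1), (((√2 : ℝ) : ℂ)⁻¹ * (1 / 2 : ℂ) ^ (r : ℕ) *
      ((r : ℕ).choose q : ℂ)) • quarkCoeff p j k r)
    (fun q _ => coeFn_quarkLp q) (fun q' hq' k' => ?_) hf
  · rw [key, _root_.sum_apply]
    rfl
  have hle : ∀ l ∈ Finset.range (q' + 1), l ≤ p := fun l hl =>
    (Nat.lt_succ_iff.1 (Finset.mem_range.1 hl)).trans hq'
  conv_lhs => rw [dilTrans_quarkLp_refinement]
  rw [map_smul, map_add, map_sum, _root_.sum_apply,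
    quarkCoeff_dilTrans _ _ _ _ _ hq', if_neg (by omega), zero_add,
    Finset.sum_eq_single (⟨q', Nat.lt_succ_of_le hq'⟩ : Fin (p + 1))]
  · rw [_root_.smul_apply, quarkCoeff_dilTrans _ _ _ _ _ hq']
    have h1 : ∑ l ∈ Finset.range (q' + 1), quarkCoeff p (j + 1) (2 * k + 1) q
        ((q'.choose l : ℂ) • dilTrans (j + 1) (2 * k' + 1) (quarkLp l)) =
        if k = k' then (q'.choose q : ℂ) else 0 := by
      have h2 : ∀ l ∈ Finset.range (q' + 1), quarkCoeff p (j + 1) (2 * k + 1) q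
          ((q'.choose l : ℂ) • dilTrans (j + 1) (2 * k' + 1) (quarkLp l)) =
          if (q : ℕ) = l then (if k = k' then (q'.choose q : ℂ) else 0) else 0 := by
        intro l hl
        rw [map_smul, quarkCoeff_dilTrans _ _ _ _ _ (hle l hl)]
        by_cases hk : k = k'
        · by_cases hql : (q : ℕ) = l
          · simp [hk, hql]
          · simp [hql]
        · simp [hk]
      rw [Finset.sum_congr rfl h2, Finset.sum_ite_eq]
      split_ifs with h3 h4 h4
      · rfl
      · rfl
      · rw [Nat.choose_eq_zero_of_lt (by simpa using h3), Nat.cast_zero]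
      · rfl
    rw [h1]
    by_cases hk : k = k' <;> simp [hk]
  · intro r _ hr
    rw [_root_.smul_apply, quarkCoeff_dilTrans _ _ _ _ _ hq', if_neg, smul_zero]
    rintro ⟨_, h⟩
    exact hr (Fin.ext h)
  · simp

end Refinement

/-! ### Independence of the levels -/

section Directness

/-- The substitution `i ↦ 1 - 2n - i` exchanges the two mask factors and flips the sign, so the sum
equals its negative. -/
theorem sum_waveletCoeff_mul_dualMask (mt : ℕ) (n : ℤ) :
    ∑ᶠ i : ℤ, waveletCoeff mt i * (dualMask mt).coeff (i + 2 * n) = 0 := by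
  have h : ∑ᶠ i : ℤ, waveletCoeff mt i * (dualMask mt).coeff (i + 2 * n) =
      ∑ᶠ i : ℤ, -(waveletCoeff mt i * (dualMask mt).coeff (i + 2 * n)) := by
    rw [← finsum_comp_equiv (Equiv.subLeft (1 - 2 * n))]
    refine finsum_congr fun i => ?_
    rw [Equiv.subLeft_apply, waveletCoeff, waveletCoeff,
      show (1 : ℤ) - (1 - 2 * n - i) = i + 2 * n by ring,
      show (1 : ℤ) - 2 * n - i + 2 * n = 1 - i by ring]
    have e : (-1 : ℝ) ^ (1 - 2 * n - i) = -(-1) ^ i := by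
      rcases Int.even_or_odd i with h | h
      · rw [h.neg_one_zpow, Odd.neg_one_zpow]
        obtain ⟨a, rfl⟩ := h
        exact ⟨-n - a, by ring⟩
      · rw [h.neg_one_zpow, Even.neg_one_zpow]
        · ring
        · obtain ⟨a, rfl⟩ := h
          exact ⟨-n - a, by ring⟩
    rw [e]
    ring
  rw [finsum_neg_distrib] at h
  linarith

theorem sum_dualMask_quarkCoeff_of_mem_spaceW {mt p : ℕ} {j : ℤ} {f : L2R}
    (hf : f ∈ spaceW mt p j) (m : ℤ) (q : Fin (p + 1)) :
    ∑ k ∈ (dualMask mt).coeff.support,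
      ((dualMask mt).coeff k : ℂ) * quarkCoeff p (j + 1) (k + 2 * m) q f = 0 := by
  have key := eqOn_shiftSpace (φ := ∑ k ∈ (dualMask mt).coeff.support,
      ((dualMask mt).coeff k : ℂ) • quarkCoeff p (j + 1) (k + 2 * m) q) (ψ := 0)
    (fun q _ => coeFn_quarkletLp mt q) (fun q' hq' m' => ?_) hf
  · rw [_root_.sum_apply] at key
    exact key
  rw [dilTrans_quarkletLp, map_sum, _root_.zero_apply]
  have h1 : ∀ i : ℤ, (∑ k ∈ (dualMask mt).coeff.support,
      ((dualMask mt).coeff k : ℂ) • quarkCoeff p (j + 1) (k + 2 * m) q)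
      (((waveletCoeff mt i / √2 : ℝ) : ℂ) • dilTrans (j + 1) (2 * m' + i) (quarkLp q')) =
      ((if (q : ℕ) = q' then (√2)⁻¹ else 0) *
        (waveletCoeff mt i * (dualMask mt).coeff (i + 2 * (m' - m))) : ℝ) := by
    intro i
    rw [map_smul, _root_.sum_apply]
    have h2 : ∀ k ∈ (dualMask mt).coeff.support, (((dualMask mt).coeff k : ℂ) •
        quarkCoeff p (j + 1) (k + 2 * m) q) (dilTrans (j + 1) (2 * m' + i) (quarkLp q')) =
        if i + 2 * (m' - m) = k then
          (((dualMask mt).coeff (i + 2 * (m' - m)) * if (q : ℕ) = q' then 1 else 0 : ℝ) : ℂ)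
        else 0 := by
      intro k _
      rw [_root_.smul_apply, quarkCoeff_dilTrans _ _ _ _ _ hq']
      by_cases hk : i + 2 * (m' - m) = k
      · subst hk
        have : i + 2 * (m' - m) + 2 * m = 2 * m' + i := by ring
        by_cases hq : (q : ℕ) = q' <;> simp [this, hq]
      · rw [if_neg hk, if_neg (by omega), smul_zero]
    rw [Finset.sum_congr rfl h2, Finset.sum_ite_eq]
    by_cases h3 : i + 2 * (m' - m) ∈ (dualMask mt).coeff.support
    · rw [if_pos h3]
      split_ifs <;> simp
      ring
    · have h4 : (dualMask mt).coeff (i + 2 * (m' - m)) = 0 := by simpa using h3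
      simp [h4]
  simp_rw [h1]
  rw [← Complex.ofReal_sum, ← Finset.mul_sum, ← finsum_eq_sum_of_support_subset
    (fun i => waveletCoeff mt i * (dualMask mt).coeff (i + 2 * (m' - m))),
    sum_waveletCoeff_mul_dualMask]
  · simp
  · intro i hi
    have := left_ne_zero_of_mul hi
    simpa [waveletFinsupp_apply] using this

/-- Splitting `c` into an even-supported `Z` and its shift turns the mask into `ã_k + ã_{k+1}`,
twice the interpolatory mask, which on even indices is `2δ_0`. -/
theorem sum_dualMask_mul_halves (mt : ℕ) (Y c : ℤ → ℂ) (h0 : ∀ n, c (2 * n) = Y n)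
    (h1 : ∀ n, c (2 * n + 1) = Y n) :
    ∑ k ∈ (dualMask mt).coeff.support, ((dualMask mt).coeff k : ℂ) * c k = 2 * Y 0 := by
  set Z : ℤ → ℂ := fun k => if Even k then c k else 0 with hZ
  have hc : ∀ k, c k = Z k + Z (k - 1) := by
    intro k
    rcases Int.even_or_odd' k with ⟨n, rfl | rfl⟩
    · have : ¬ Even (2 * n - 1) := by rw [Int.not_even_iff_odd]; exact ⟨n - 1, by ring⟩
      simp [hZ, this]
    · have : ¬ Even (2 * n + 1) := by rw [Int.not_even_iff_odd]; exact ⟨n, rfl⟩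
      simp [hZ, this, h0, h1]
  have hfin : (Function.support fun k : ℤ => ((dualMask mt).coeff k : ℂ)).Finite :=
    (dualMask mt).coeff.support.finite_toSet.subset fun k hk => by simpa using hk
  have hf1 : (Function.support fun k : ℤ => ((dualMask mt).coeff k : ℂ) * Z k).Finite :=
    hfin.subset fun k hk => left_ne_zero_of_mul hk
  have hf2 : (Function.support fun k : ℤ => ((dualMask mt).coeff k : ℂ) * Z (k - 1)).Finite :=
    hfin.subset fun k hk => left_ne_zero_of_mul hk
  have hf3 : (Function.support fun k : ℤ => ((dualMask mt).coeff (k + 1) : ℂ) * Z k).Finite := by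
    refine (hf2.preimage (f := fun k : ℤ => k + 1) (fun a _ b _ h => by simpa using h)).subset ?_
    intro k hk
    simpa using hk
  rw [← finsum_eq_sum_of_support_subset (fun k : ℤ => ((dualMask mt).coeff k : ℂ) * c k)
    (fun k hk => by simpa using left_ne_zero_of_mul hk)]
  simp_rw [hc, mul_add]
  rw [finsum_add_distrib hf1 hf2, ← finsum_comp_equiv
    (f := fun k : ℤ => ((dualMask mt).coeff k : ℂ) * Z (k - 1)) (Equiv.addRight (1 : ℤ))]
  simp only [Equiv.coe_addRight, add_sub_cancel_right]
  rw [← finsum_add_distrib hf1 hf3, finsum_eq_single _ 0]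
  · have e := interpMask_coeff_even mt 0
    rw [mul_zero, interpMask_coeff, if_pos rfl, div_eq_iff two_ne_zero, one_mul] at e
    have e' := congrArg (fun t : ℝ => (t : ℂ)) e
    rw [Complex.ofReal_add, Complex.ofReal_ofNat] at e'
    have hZ0 : Z 0 = Y 0 := by simpa [hZ] using h0 0
    rw [← add_mul, e', hZ0]
  · intro k hk
    rw [← add_mul]
    by_cases hev : Even k
    · obtain ⟨n, rfl⟩ := hev
      have e := interpMask_coeff_even mt n
      rw [interpMask_coeff, if_neg (by omega), div_eq_zero_iff] at e
      have e' := congrArg (fun t : ℝ => (t : ℂ)) (e.resolve_right two_ne_zero)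
      push_cast at e'
      rw [← two_mul, e', zero_mul]
    · simp [hZ, hev]

theorem disjoint_spaceV_spaceW (mt p : ℕ) (j : ℤ) : Disjoint (spaceV p j) (spaceW mt p j) := by
  rw [Submodule.disjoint_def]
  intro f hV hW
  refine eq_zero_of_mem_spaceV hV ?_
  -- Descending induction on the degree: stage `n` covers the top `n` degrees, and stage 0 is
  -- vacuous because `q ≤ p`.
  suffices h : ∀ n : ℕ, ∀ q : Fin (p + 1), p < (q : ℕ) + n → ∀ k, quarkCoeff p j k q f = 0 from
    fun k q => h (p + 1) q (by omega) k
  intro n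
  induction n with
  | zero => intro q hq; omega
  | succ n ih =>
    intro q hq m
    set κ : ℂ := ((√2 : ℝ) : ℂ)⁻¹ * (1 / 2 : ℂ) ^ (q : ℕ) with hκ
    have hκ0 : κ ≠ 0 := mul_ne_zero (inv_ne_zero (Complex.ofReal_ne_zero.2 (by positivity)))
      (pow_ne_zero _ (by norm_num))
    have h := sum_dualMask_quarkCoeff_of_mem_spaceW hW m q
    rw [sum_dualMask_mul_halves mt (fun n => κ * quarkCoeff p j (n + m) q f)] at h
    · simpa [hκ0] using h
    · intro n
      rw [← mul_add, quarkCoeff_even_of_mem_spaceV hV]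
    · intro n
      rw [show 2 * n + 1 + 2 * m = 2 * (n + m) + 1 by ring, quarkCoeff_odd_of_mem_spaceV hV,
        Finset.sum_eq_single q]
      · simp [hκ]
      · intro r _ hr
        rcases lt_or_gt_of_ne hr with hlt | hlt
        · rw [Nat.choose_eq_zero_of_lt (by exact_mod_cast hlt)]
          simp
        · have : (q : ℕ) < r := by exact_mod_cast hlt
          rw [ih r (by omega), mul_zero]
      · simp

/-- A family of subspaces adapted to an increasing filtration is independent. -/
theorem iSupIndep_of_filtration {R M : Type*} [Ring R] [AddCommGroup M] [Module R M]
    {V W : ℤ → Submodule R M} (hV : Monotone V) (hW : ∀ j, W j ≤ V (j + 1))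
    (hd : ∀ j, Disjoint (V j) (W j)) : iSupIndep W := by
  rw [iSupIndep_iff_finsetSum_eq_zero_imp_eq_zero]
  intro s
  induction s using Finset.induction_on_max with
  | empty => simp
  | insert a s ha ih =>
    intro v hv hsum
    rw [Finset.sum_insert (fun h => (ha a h).false)] at hsum
    have h1 : ∑ i ∈ s, v i ∈ V a := Submodule.sum_mem _ fun i hi =>
      hV (Int.add_one_le_iff.2 (ha i hi)) (hW i (hv i (Finset.mem_insert_of_mem hi)))
    have h2 : v a ∈ V a := by
      rw [eq_neg_of_add_eq_zero_left hsum]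
      exact Submodule.neg_mem _ h1
    have h3 : v a = 0 := Submodule.disjoint_def.1 (hd a) _ h2 (hv a (Finset.mem_insert_self _ _))
    rw [h3, zero_add] at hsum
    intro i hi
    rcases Finset.mem_insert.1 hi with rfl | hi
    · exact h3
    · exact ih v (fun i hi => hv i (Finset.mem_insert_of_mem hi)) hsum i hi

theorem iSupIndep_spaceW (mt p : ℕ) : iSupIndep (spaceW mt p) :=
  iSupIndep_of_filtration (spaceV_mono p) (spaceW_le_spaceV mt p) (disjoint_spaceV_spaceW mt p)

theorem iSupIndep_consFamily (mt p : ℕ) :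
    iSupIndep (consFamily (spaceV p 0) fun j : ℕ => spaceW mt p j) := by
  -- `V_{p,0}` is placed at index `-1` and zero spaces below it, so the lemma on integer filtrations
  -- applies.
  have key : iSupIndep fun j : ℤ =>
      if 0 ≤ j then spaceW mt p j else if j = -1 then spaceV p 0 else ⊥ := by
    refine iSupIndep_of_filtration (V := fun j => if 0 ≤ j then spaceV p j else ⊥) ?_ ?_ ?_
    · intro i j hij
      dsimp only
      split_ifs with h1 h2 h2
      · exact spaceV_mono p hij
      · omega
      · exact bot_le
      · exact le_rfl
    · intro j
      by_cases h1 : 0 ≤ j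
      · rw [if_pos h1, if_pos (by omega)]
        exact spaceW_le_spaceV mt p j
      · by_cases h2 : j = -1
        · subst h2
          simp
        · rw [if_neg h1, if_neg h2]
          exact bot_le
    · intro j
      split_ifs
      · exact disjoint_spaceV_spaceW mt p j
      · exact disjoint_bot_left
      · exact disjoint_bot_left
  have hinj : Function.Injective fun o : Option ℕ => o.elim (-1 : ℤ) fun n => (n : ℤ) := by
    rintro (_ | a) (_ | b) h <;> simp at h ⊢ <;> omega
  convert key.comp hinj using 1
  ext1 o
  cases o <;> simp [consFamily]

end Directness

/-! ### Density of the sums of levels -/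

section Totality

theorem topologicalClosure_iSup_spaceW (mt p : ℕ) :
    (⨆ j, spaceW mt p j).topologicalClosure = ⊤ := by
  rw [Submodule.topologicalClosure_eq_top_iff, Submodule.eq_bot_iff]
  intro f hf
  refine eq_zero_of_orthogonal_wavelets (mt := mt) fun j k => ?_
  exact hf _ (Submodule.mem_iSup_of_mem j
    (dilTrans_mem_shiftSpace (fun q _ => coeFn_quarkletLp mt q) j (Set.mem_Iic.2 (Nat.zero_le p)) k))

theorem topologicalClosure_iSup_consFamily (mt p : ℕ) :
    (⨆ o, consFamily (spaceV p 0) (fun j : ℕ => spaceW mt p j) o).topologicalClosure = ⊤ := by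
  rw [Submodule.topologicalClosure_eq_top_iff, Submodule.eq_bot_iff]
  intro f hf
  refine eq_zero_of_orthogonal_quark_wavelets (mt := mt) (fun k => ?_) fun j k => ?_
  · exact hf _ (Submodule.mem_iSup_of_mem none
      (dilTrans_mem_shiftSpace (fun q _ => coeFn_quarkLp q) 0 (Set.mem_Iic.2 (Nat.zero_le p)) k))
  · exact hf _ (Submodule.mem_iSup_of_mem (some j)
      (dilTrans_mem_shiftSpace (fun q _ => coeFn_quarkletLp mt q) j (Set.mem_Iic.2 (Nat.zero_le p)) k))

end Totality

/-! ### The `L₂` Fourier transform by duality -/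

open scoped FourierTransform

theorem integral_fourier_mul_eq {f g : ℝ → ℂ} (hf : Integrable f) (hg : Integrable g) :
    ∫ ξ, 𝓕 f ξ * g ξ = ∫ x, f x * 𝓕 g x := by
  have := VectorFourier.integral_fourierIntegral_smul_eq_flip (μ := (volume : Measure ℝ))
    (ν := (volume : Measure ℝ)) (L := innerₗ ℝ) Real.continuous_fourierChar continuous_inner hf hg
  rw [flip_innerₗ] at this
  exact this

/-- The defining duality of the Fourier transform on `L₂(ℝ)`. -/
theorem integral_mul_fourier_L2R (f : L2R) (g : SchwartzMap ℝ ℂ) :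
    ∫ x, g x * (Lp.fourierTransformₗᵢ ℝ ℂ f : L2R) x = ∫ x, 𝓕 (g : ℝ → ℂ) x * f x := by
  have h := Lp.fourier_toTemperedDistribution_eq f
  have h2 := congrArg (fun T : TemperedDistribution ℝ ℂ => T g) h
  simp only [TemperedDistribution.fourier_apply, Lp.toTemperedDistribution_apply, smul_eq_mul] at h2
  rw [← SchwartzMap.fourier_coe]
  exact h2.symm

theorem ae_eq_of_integral_schwartz {f f' : ℝ → ℂ} (hf : LocallyIntegrable f)
    (hf' : LocallyIntegrable f')
    (h : ∀ g : SchwartzMap ℝ ℂ, HasCompactSupport g → ∫ x, g x * f x = ∫ x, g x * f' x) :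
    f =ᵐ[volume] f' := by
  refine ae_eq_of_integral_contDiff_smul_eq hf hf' fun g hg hc => ?_
  have h1 : HasCompactSupport (fun x => (g x : ℂ)) := hc.comp_left (g := fun t : ℝ => (t : ℂ)) rfl
  have h2 : ContDiff ℝ (⊤ : ℕ∞) (fun x => (g x : ℂ)) := Complex.ofRealCLM.contDiff.comp hg
  have := h (h1.toSchwartzMap h2) h1
  simpa [Complex.real_smul] using this

theorem continuous_fourierIntegral {f : ℝ → ℂ} (hf : Integrable f) : Continuous (𝓕 f) :=
  VectorFourier.fourierIntegral_continuous Real.continuous_fourierChar continuous_inner hf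

/-- On `L₁ ∩ L₂` the `L₂` Fourier transform is given by the Fourier integral. -/
theorem fourierTransform_ae_eq_fourierIntegral {f : ℝ → ℂ} (hf : Integrable f) {F : L2R}
    (hF : F =ᵐ[volume] f) : (Lp.fourierTransformₗᵢ ℝ ℂ F : L2R) =ᵐ[volume] 𝓕 f := by
  refine ae_eq_of_integral_schwartz (locallyIntegrable_L2R _)
    (continuous_fourierIntegral hf).locallyIntegrable fun g _ => ?_
  rw [integral_mul_fourier_L2R, ← integral_fourier_mul_eq g.integrable hf]
  exact integral_congr_ae (by filter_upwards [hF] with x hx; simp only [hx])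

theorem fourier_translate_L2R (f : L2R) (k : ℤ) :
    (Lp.fourierTransformₗᵢ ℝ ℂ (dilTrans 0 k f) : L2R) =ᵐ[volume] fun η =>
      Complex.exp (-(2 * Real.pi * k * η * Complex.I)) * (Lp.fourierTransformₗᵢ ℝ ℂ f : L2R) η := by
  have hcont : Continuous fun η : ℝ => Complex.exp (-(2 * Real.pi * k * η * Complex.I)) := by
    fun_prop
  refine ae_eq_of_integral_schwartz (locallyIntegrable_L2R _) ?_ fun g hg => ?_
  · exact (locallyIntegrable_L2R _).continuous_mul hcont
  -- Testing against compactly supported `g` makes the modulated function, being smooth, again a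
  -- Schwartz function.
  have hsupp : HasCompactSupport fun η : ℝ =>
      Complex.exp (-(2 * Real.pi * k * η * Complex.I)) * g η := hg.mul_left
  have hsm : ContDiff ℝ (⊤ : ℕ∞) fun η : ℝ =>
      Complex.exp (-(2 * Real.pi * k * η * Complex.I)) * g η := by
    refine ContDiff.mul ?_ (g.smooth _)
    refine ContDiff.cexp (ContDiff.neg (ContDiff.mul (ContDiff.mul contDiff_const ?_) contDiff_const))
    exact Complex.ofRealCLM.contDiff
  set g' : SchwartzMap ℝ ℂ := hsupp.toSchwartzMap hsm with hg'
  have hg'x : ∀ η, g' η = Complex.exp (-(2 * Real.pi * k * η * Complex.I)) * g η := fun η => rfl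
  have hshift : ∀ x : ℝ, 𝓕 (g' : ℝ → ℂ) x = 𝓕 (g : ℝ → ℂ) (x + k) := by
    intro x
    rw [Real.fourier_real_eq_integral_exp_smul, Real.fourier_real_eq_integral_exp_smul]
    refine integral_congr_ae (Filter.Eventually.of_forall fun y => ?_)
    simp only [hg'x, smul_eq_mul]
    rw [← mul_assoc, ← Complex.exp_add]
    congr 2
    push_cast
    ring
  calc ∫ x, g x * (Lp.fourierTransformₗᵢ ℝ ℂ (dilTrans 0 k f) : L2R) x
      = ∫ x, 𝓕 (g : ℝ → ℂ) x * (dilTrans 0 k f : L2R) x := integral_mul_fourier_L2R _ _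
    _ = ∫ x, (fun y => 𝓕 (g : ℝ → ℂ) (y + k) * f y) (x - k) := by
        refine integral_congr_ae ?_
        filter_upwards [dilTrans_ae 0 k (Filter.EventuallyEq.refl _ (f : ℝ → ℂ))] with x hx
        rw [hx]
        simp
    _ = ∫ x, 𝓕 (g : ℝ → ℂ) (x + k) * f x :=
        integral_sub_right_eq_self (fun y => 𝓕 (g : ℝ → ℂ) (y + k) * f y) (k : ℝ)
    _ = ∫ x, 𝓕 (g' : ℝ → ℂ) x * f x := by simp_rw [hshift]
    _ = ∫ x, g' x * (Lp.fourierTransformₗᵢ ℝ ℂ f : L2R) x := (integral_mul_fourier_L2R _ _).symm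
    _ = _ := by
        refine integral_congr_ae (Filter.Eventually.of_forall fun y => ?_)
        simp only [hg'x]
        ring

/-! ### Periodization and the bracket -/

section Periodization

theorem lintegral_eq_lintegral_tsum {h : ℝ → ENNReal} (hh : AEMeasurable h) :
    ∫⁻ x, h x = ∫⁻ x in Set.Ioc (0 : ℝ) 1, ∑' n : ℤ, h (x + n) := by
  have hmp : ∀ n : ℤ, MeasurePreserving (fun x : ℝ => x + n) volume volume := fun n =>
    measurePreserving_add_right volume _
  have hm : ∀ n : ℤ, AEMeasurable (fun x : ℝ => h (x + n))
      (volume.restrict (Set.Ioc (0 : ℝ) 1)) := fun n =>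
    (hh.comp_quasiMeasurePreserving (hmp n).quasiMeasurePreserving).restrict
  rw [lintegral_tsum hm, ← setLIntegral_univ, ← iUnion_Ioc_intCast ℝ,
    lintegral_iUnion (fun n => measurableSet_Ioc) (Set.pairwise_disjoint_Ioc_intCast ℝ)]
  refine tsum_congr fun n => ?_
  have := (hmp n).setLIntegral_comp_preimage_emb (measurableEmbedding_addRight _) h
    (Set.Ioc (n : ℝ) (n + 1))
  rw [← this]
  simp

theorem ae_tsum_lt_top {h : ℝ → ENNReal} (hh : AEMeasurable h) (hfin : ∫⁻ x, h x ≠ ⊤) :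
    ∀ᵐ x ∂volume.restrict (Set.Ioc (0 : ℝ) 1), ∑' n : ℤ, h (x + n) < ⊤ := by
  have hmp : ∀ n : ℤ, MeasurePreserving (fun x : ℝ => x + n) volume volume := fun n =>
    measurePreserving_add_right volume _
  rw [lintegral_eq_lintegral_tsum hh] at hfin
  exact ae_lt_top' (AEMeasurable.tsum fun n => (hh.comp_quasiMeasurePreserving
      (hmp n).quasiMeasurePreserving).restrict) hfin

theorem integrable_tsum_and_integral_eq {h : ℝ → ℂ} (hh : Integrable h) :
    Integrable (fun x => ∑' n : ℤ, h (x + n)) (volume.restrict (Set.Ioc (0 : ℝ) 1)) ∧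
      ∫ x, h x = ∫ x in Set.Ioc (0 : ℝ) 1, ∑' n : ℤ, h (x + n) := by
  have hmp : ∀ n : ℤ, MeasurePreserving (fun x : ℝ => x + n) volume volume := fun n =>
    measurePreserving_add_right volume _
  have hm : ∀ n : ℤ, AEStronglyMeasurable (fun x : ℝ => h (x + n))
      (volume.restrict (Set.Ioc (0 : ℝ) 1)) := fun n =>
    (hh.1.comp_quasiMeasurePreserving (hmp n).quasiMeasurePreserving).restrict
  have hl : ∫⁻ x, ‖h x‖ₑ = ∫⁻ x in Set.Ioc (0 : ℝ) 1, ∑' n : ℤ, ‖h (x + n)‖ₑ :=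
    lintegral_eq_lintegral_tsum hh.1.enorm
  constructor
  · refine ⟨?_, ?_⟩
    · exact (AEMeasurable.tsum fun n => (hm n).aemeasurable).aestronglyMeasurable
    · refine lt_of_le_of_lt ?_ hh.2
      rw [hl]
      refine lintegral_mono fun x => ?_
      exact enorm_tsum_le_tsum_enorm
  · rw [integral_tsum hm, ← setIntegral_univ, ← iUnion_Ioc_intCast ℝ,
      integral_iUnion (fun n => measurableSet_Ioc) (Set.pairwise_disjoint_Ioc_intCast ℝ)
      hh.integrableOn]
    · refine tsum_congr fun n => ?_
      have := (hmp n).setIntegral_preimage_emb (measurableEmbedding_addRight _) h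
        (Set.Ioc (n : ℝ) (n + 1))
      rw [← this]
      simp
    · rw [← lintegral_tsum fun n => (hm n).enorm, ← hl]
      exact hh.2.ne

/-- An integrable function on the circle whose Fourier coefficients all vanish is zero. -/
theorem ae_eq_zero_of_fourierCoeff_eq_zero {B : ℝ → ℂ}
    (hB : Integrable B (volume.restrict (Set.Ioc (0 : ℝ) 1)))
    (h : ∀ k : ℤ, ∫ x in Set.Ioc (0 : ℝ) 1, Complex.exp (2 * Real.pi * k * x * Complex.I) * B x = 0) :
    ∀ᵐ x ∂volume.restrict (Set.Ioc (0 : ℝ) 1), B x = 0 := by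
  have hmeas : ∀ g : C(AddCircle (1 : ℝ), ℂ), Continuous fun x : ℝ => g (x : AddCircle (1 : ℝ)) :=
    fun g => g.continuous.comp (AddCircle.continuous_mk' 1)
  have hint : ∀ g : C(AddCircle (1 : ℝ), ℂ), Integrable
      (fun x : ℝ => g (x : AddCircle (1 : ℝ)) * B x) (volume.restrict (Set.Ioc (0 : ℝ) 1)) :=
    fun g => hB.bdd_mul (c := ‖g‖) (hmeas g).aestronglyMeasurable
      (Filter.Eventually.of_forall fun x => g.norm_coe_le_norm _)
  let Φ₀ : C(AddCircle (1 : ℝ), ℂ) →ₗ[ℂ] ℂ :=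
    { toFun := fun g => ∫ x in Set.Ioc (0 : ℝ) 1, g (x : AddCircle (1 : ℝ)) * B x
      map_add' := fun g g' => by
        rw [← integral_add (hint g) (hint g')]
        simp [add_mul]
      map_smul' := fun c g => by
        rw [RingHom.id_apply, smul_eq_mul, ← integral_const_mul]
        simp [mul_assoc] }
  -- Integration against `B` is a continuous functional on `C(𝕋)`. It kills the trigonometric
  -- polynomials, which are dense, hence also the bump functions supported in `(0, 1)`.
  let Φ : C(AddCircle (1 : ℝ), ℂ) →L[ℂ] ℂ :=
    Φ₀.mkContinuous (∫ x in Set.Ioc (0 : ℝ) 1, ‖B x‖) fun g => by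
      refine (norm_integral_le_integral_norm _).trans ?_
      rw [mul_comm, ← integral_const_mul]
      refine integral_mono (hint g).norm (hB.norm.const_mul _) fun x => ?_
      simp only [norm_mul]
      gcongr
      exact g.norm_coe_le_norm _
  have : Fact ((0 : ℝ) < 1) := ⟨one_pos⟩
  have hker : ∀ g, Φ g = 0 := by
    intro g
    have hle : (Submodule.span ℂ (Set.range (_root_.fourier (T := (1 : ℝ))))).topologicalClosure ≤
        Φ.ker := by
      refine Submodule.topologicalClosure_minimal _ (Submodule.span_le.2 ?_) Φ.isClosed_ker
      rintro _ ⟨k, rfl⟩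
      change ∫ x in Set.Ioc (0 : ℝ) 1, _root_.fourier k (x : AddCircle (1 : ℝ)) * B x = 0
      rw [← h k]
      refine integral_congr_ae (Filter.Eventually.of_forall fun x => ?_)
      simp only [fourier_coe_apply]
      congr 2
      push_cast
      ring
    rw [span_fourier_closure_eq_top] at hle
    exact hle (Submodule.mem_top (x := g))
  have hmain : ∀ᵐ x : ℝ, x ∈ Set.Ioo (0 : ℝ) 1 → B x = 0 := by
    refine isOpen_Ioo.ae_eq_zero_of_integral_contDiff_smul_eq_zero ?_ fun g hg hc hs => ?_
    · exact (IntegrableOn.mono_set hB Set.Ioo_subset_Ioc_self).locallyIntegrableOn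
    have hout : ∀ x, x ∉ Set.Ioo (0 : ℝ) 1 → g x = 0 := fun x hx =>
      image_eq_zero_of_notMem_tsupport fun h => hx (hs h)
    have hcont : Continuous (AddCircle.liftIco 1 0 fun x : ℝ => (g x : ℂ)) := by
      refine AddCircle.liftIco_continuous ?_ ?_
      · rw [hout 0 (by simp), hout (0 + 1) (by simp)]
      · exact (Complex.continuous_ofReal.comp hg.continuous).continuousOn
    have h0 := hker ⟨_, hcont⟩
    change ∫ x in Set.Ioc (0 : ℝ) 1, AddCircle.liftIco 1 0 (fun x : ℝ => (g x : ℂ))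
      (x : AddCircle (1 : ℝ)) * B x = 0 at h0
    rw [integral_Ioc_eq_integral_Ioo] at h0
    rw [← h0, ← setIntegral_eq_integral_of_forall_compl_eq_zero (s := Set.Ioo (0 : ℝ) 1)]
    · refine setIntegral_congr_fun measurableSet_Ioo fun x hx => ?_
      rw [AddCircle.liftIco_coe_apply (by rw [zero_add]; exact Set.Ioo_subset_Ico_self hx),
        Complex.real_smul]
    · intro x hx
      rw [hout x hx, zero_smul]
  rw [← restrict_Ioo_eq_restrict_Ioc, ae_restrict_iff' measurableSet_Ioo]
  exact hmain

/-- The bracket of the Fourier transforms of two `L₂` functions, on the unit interval. -/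
theorem forall_inner_translate_eq_zero_iff (ψ g : L2R) {H G : ℝ → ℂ}
    (hH : (Lp.fourierTransformₗᵢ ℝ ℂ ψ : L2R) =ᵐ[volume] H)
    (hG : (Lp.fourierTransformₗᵢ ℝ ℂ g : L2R) =ᵐ[volume] G) :
    (∀ k : ℤ, inner ℂ (dilTrans 0 k ψ) g = 0) ↔
      ∀ᵐ η ∂volume.restrict (Set.Ioc (0 : ℝ) 1),
        ∑' n : ℤ, inner ℂ (H (η + n)) (G (η + n)) = 0 := by
  have hprod : Integrable fun η => inner ℂ (H η) (G η) :=
    (L2.integrable_inner (Lp.fourierTransformₗᵢ ℝ ℂ ψ) (Lp.fourierTransformₗᵢ ℝ ℂ g)).congr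
      (by filter_upwards [hH, hG] with x h1 h2; rw [h1, h2])
  -- By Plancherel, translation by `k` becomes a 1-periodic character that factors out of the
  -- periodization, so these inner products are the Fourier coefficients of the bracket.
  have hkey : ∀ k : ℤ, inner ℂ (dilTrans 0 k ψ) g = ∫ η in Set.Ioc (0 : ℝ) 1,
      Complex.exp (2 * Real.pi * k * η * Complex.I) *
        ∑' n : ℤ, inner ℂ (H (η + n)) (G (η + n)) := by
    intro k
    have hI : Integrable fun η : ℝ => Complex.exp (2 * Real.pi * k * η * Complex.I) *
        inner ℂ (H η) (G η) := by
      refine hprod.bdd_mul (c := 1) ?_ (Filter.Eventually.of_forall fun η => ?_)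
      · exact (Continuous.aestronglyMeasurable (by fun_prop))
      · have : (2 * Real.pi * k * η * Complex.I : ℂ) = ((2 * Real.pi * k * η : ℝ) : ℂ) *
          Complex.I := by push_cast; ring
        rw [this, Complex.norm_exp_ofReal_mul_I]
    rw [← (Lp.fourierTransformₗᵢ ℝ ℂ).inner_map_map, L2.inner_def]
    have h1 : ∫ η, inner ℂ ((Lp.fourierTransformₗᵢ ℝ ℂ (dilTrans 0 k ψ) : L2R) η)
        ((Lp.fourierTransformₗᵢ ℝ ℂ g : L2R) η) =
        ∫ η : ℝ, Complex.exp (2 * Real.pi * k * η * Complex.I) * inner ℂ (H η) (G η) := by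
      refine integral_congr_ae ?_
      filter_upwards [fourier_translate_L2R ψ k, hH, hG] with η h1 h2 h3
      rw [h1, h2, h3]
      simp only [RCLike.inner_apply, map_mul, ← Complex.exp_conj, map_neg, Complex.conj_ofReal,
        Complex.conj_I, map_ofNat, map_intCast]
      rw [mul_left_comm]
      congr 2
      ring
    rw [h1, (integrable_tsum_and_integral_eq hI).2]
    refine integral_congr_ae (Filter.Eventually.of_forall fun η => ?_)
    simp only
    rw [← tsum_mul_left]
    refine tsum_congr fun n => ?_
    congr 1
    have := Complex.exp_int_mul_two_pi_mul_I (k * n)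
    have e : (2 * Real.pi * k * ((η + n : ℝ) : ℂ) * Complex.I : ℂ) =
        2 * Real.pi * k * η * Complex.I + ((k * n : ℤ) : ℂ) * (2 * Real.pi * Complex.I) := by
      push_cast; ring
    rw [e, Complex.exp_add, this, mul_one]
  simp_rw [hkey]
  constructor
  · exact ae_eq_zero_of_fourierCoeff_eq_zero (integrable_tsum_and_integral_eq hprod).1
  · intro h k
    refine integral_eq_zero_of_ae ?_
    filter_upwards [h] with η hη
    rw [hη, mul_zero]
    rfl

theorem ae_memℓp_fiber {h : ℝ → ℂ} (hh : MemLp h 2 volume) :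
    ∀ᵐ η ∂volume.restrict (Set.Ioc (0 : ℝ) 1), Memℓp (fun n : ℤ => h (η + n)) 2 := by
  have hfin := lintegral_rpow_enorm_lt_top_of_eLpNorm_lt_top two_ne_zero ENNReal.ofNat_ne_top hh.2
  filter_upwards [ae_tsum_lt_top (hh.1.enorm.pow_const _) hfin.ne] with η hη
  refine memℓp_gen ?_
  have := ENNReal.summable_toReal hη.ne
  refine this.congr fun n => ?_
  rw [← ENNReal.toReal_rpow, toReal_enorm]

end Periodization

/-! ### Fibrewise Gram-Schmidt and square integrability -/

section StarHat

theorem integrable_quarklet (mt q : ℕ) : Integrable (quarklet mt q) := by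
  have h : quarklet mt q = fun x => ∑ k ∈ (waveletFinsupp mt).support,
      (waveletCoeff mt k : ℂ) * quark q (2 * x - k) := funext (quarklet_eq_sum mt q)
  rw [h]
  refine integrable_finsetSum _ fun k _ => Integrable.const_mul ?_ _
  have h1 := (memLp_one_iff_integrable.1 (memLp_quark q 1)).comp_sub_right (k : ℝ)
  exact h1.comp_mul_left' two_ne_zero

theorem rescale_fourier (f : ℝ → ℂ) : rescale (fourier f) = 𝓕 f := by
  ext η
  have h : ((Real.sqrt (2 * Real.pi) : ℝ) : ℂ) ≠ 0 :=
    Complex.ofReal_ne_zero.2 (by positivity)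
  rw [rescale, fourier, Real.fourier_real_eq_integral_exp_smul, ← mul_assoc, Complex.ofReal_div,
    Complex.ofReal_one, mul_one_div_cancel h, one_mul]
  refine integral_congr_ae (Filter.Eventually.of_forall fun x => ?_)
  simp only [smul_eq_mul]
  rw [mul_comm]
  congr 2
  push_cast
  ring

theorem fourierTransform_quarkletLp_ae_eq (mt q : ℕ) :
    (Lp.fourierTransformₗᵢ ℝ ℂ (quarkletLp mt q) : L2R) =ᵐ[volume]
      rescale (fourier (quarklet mt q)) := by
  rw [rescale_fourier]
  exact fourierTransform_ae_eq_fourierIntegral (integrable_quarklet mt q) (coeFn_quarkletLp mt q)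

theorem memLp_rescale_fourier_quarklet (mt q : ℕ) :
    MemLp (rescale (fourier (quarklet mt q))) 2 volume :=
  (memLp_congr_ae (fourierTransform_quarkletLp_ae_eq mt q)).1 (Lp.memLp _)

theorem eq_rescale (g : ℝ → ℂ) : g = fun ξ => ((Real.sqrt (2 * Real.pi) : ℝ) : ℂ)⁻¹ *
    rescale g ((2 * Real.pi)⁻¹ * ξ - 0) := by
  ext ξ
  have h : ((Real.sqrt (2 * Real.pi) : ℝ) : ℂ) ≠ 0 :=
    Complex.ofReal_ne_zero.2 (by positivity)
  rw [rescale, sub_zero, mul_inv_cancel_left₀ (by positivity), inv_mul_cancel_left₀ h]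

theorem measurable_fourier_quarklet (mt q : ℕ) : Measurable (fourier (quarklet mt q)) := by
  rw [eq_rescale (fourier (quarklet mt q)), rescale_fourier]
  have := (continuous_fourierIntegral (integrable_quarklet mt q)).measurable
  fun_prop

theorem measurable_bracket {f g : ℝ → ℂ} (hf : Measurable f) (hg : Measurable g) :
    Measurable (bracket f g) := by
  unfold bracket
  refine Measurable.tsum fun k => ?_
  have : Measurable (starRingEnd ℂ) := Complex.continuous_conj.measurable
  fun_prop

theorem measurable_starHat (mt q : ℕ) : Measurable (starHat mt q) := by
  induction q using Nat.strong_induction_on with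
  | _ q ih =>
    rw [starHat]
    refine (measurable_fourier_quarklet mt q).sub (Finset.measurable_sum _ fun l _ => ?_)
    have hl := ih l l.isLt
    exact ((measurable_bracket (measurable_fourier_quarklet mt q) hl).div
      (measurable_bracket hl hl)).mul hl

/-- The right side does not involve `n`, by invariance of the sum over `ℤ`. Thus the quotients in
the recursion are constant on each fibre, as Gram-Schmidt coefficients must be. -/
theorem bracket_two_pi_mul_add (f g : ℝ → ℂ) (η : ℝ) (n : ℤ) :
    (2 * Real.pi : ℂ) * bracket f g (2 * Real.pi * (η + n)) =
      ∑' k : ℤ, rescale f (η + k) * (starRingEnd ℂ) (rescale g (η + k)) := by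
  have hc : ((Real.sqrt (2 * Real.pi) : ℝ) : ℂ) * ((Real.sqrt (2 * Real.pi) : ℝ) : ℂ) =
      2 * Real.pi := by
    rw [← Complex.ofReal_mul, Real.mul_self_sqrt (by positivity)]
    push_cast
    rfl
  rw [← (Equiv.addLeft n).tsum_eq, bracket, ← tsum_mul_left]
  refine tsum_congr fun k => ?_
  simp only [rescale, map_mul, Complex.conj_ofReal, Equiv.coe_addLeft, Int.cast_add]
  rw [← hc, show 2 * Real.pi * (η + n) + 2 * Real.pi * k = 2 * Real.pi * (η + (n + k)) by ring]
  ring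

open InnerProductSpace in
/-- On a fiber `η + ℤ` the recursion for the orthogonalized quarklets is the Gram-Schmidt process
in `ℓ²(ℤ)`. -/
theorem rescale_starHat_eq_gramSchmidt (mt : ℕ) (η : ℝ) (V : ℕ → lp (fun _ : ℤ => ℂ) 2)
    (hV : ∀ q (n : ℤ), V q n = rescale (fourier (quarklet mt q)) (η + n)) (q : ℕ) :
    ∀ n : ℤ, rescale (starHat mt q) (η + n) = gramSchmidt ℂ V q n := by
  induction q using Nat.strong_induction_on with
  | _ q ih =>
    intro n
    have hpi : (2 * Real.pi : ℂ) ≠ 0 := by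
      exact_mod_cast Real.two_pi_pos.ne'
    have h1 : rescale (starHat mt q) (η + n) = rescale (fourier (quarklet mt q)) (η + n) -
        ∑ l ∈ Finset.Iio q, bracket (fourier (quarklet mt q)) (starHat mt l)
          (2 * Real.pi * (η + n)) / bracket (starHat mt l) (starHat mt l)
          (2 * Real.pi * (η + n)) * rescale (starHat mt l) (η + n) := by
      unfold rescale
      rw [starHat, mul_sub, Finset.mul_sum, Nat.Iio_eq_range, Finset.sum_range]
      congr 1
      refine Finset.sum_congr rfl fun l _ => ?_
      ring
    have h2 : gramSchmidt ℂ V q n = V q n - ∑ l ∈ Finset.Iio q,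
        inner ℂ (gramSchmidt ℂ V l) (V q) / inner ℂ (gramSchmidt ℂ V l) (gramSchmidt ℂ V l) *
          gramSchmidt ℂ V l n := by
      have h := congrArg (fun v : lp (fun _ : ℤ => ℂ) 2 => v n) (gramSchmidt_def'' ℂ V q)
      simp only [lp.coeFn_add, lp.coeFn_sum, Pi.add_apply, Finset.sum_apply, lp.coeFn_smul,
        Pi.smul_apply, smul_eq_mul] at h
      rw [h, add_sub_assoc, eq_comm, add_eq_left, sub_eq_zero]
      refine Finset.sum_congr rfl fun l _ => ?_
      rw [inner_self_eq_norm_sq_to_K]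
    rw [h1, h2, hV]
    congr 1
    refine Finset.sum_congr rfl fun l hl => ?_
    have hl' := ih l (Finset.mem_Iio.1 hl)
    -- The factor `2π` cancels in the quotient. Division by zero is zero on both sides, so
    -- degenerate fibres need no separate case.
    rw [hl', ← mul_div_mul_left _ (bracket (starHat mt l) (starHat mt l) _) hpi,
      bracket_two_pi_mul_add, bracket_two_pi_mul_add, lp.inner_eq_tsum, lp.inner_eq_tsum]
    simp_rw [← hl', RCLike.inner_apply, hV]

theorem exists_fiber (mt : ℕ) : ∀ᵐ η ∂volume.restrict (Set.Ioc (0 : ℝ) 1),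
    ∃ V : ℕ → lp (fun _ : ℤ => ℂ) 2,
      (∀ q (n : ℤ), rescale (fourier (quarklet mt q)) (η + n) = V q n) ∧
      ∀ q (n : ℤ), rescale (starHat mt q) (η + n) = InnerProductSpace.gramSchmidt ℂ V q n := by
  have h : ∀ᵐ η ∂volume.restrict (Set.Ioc (0 : ℝ) 1), ∀ q : ℕ,
      Memℓp (fun n : ℤ => rescale (fourier (quarklet mt q)) (η + n)) 2 :=
    ae_all_iff.2 fun q => ae_memℓp_fiber (memLp_rescale_fourier_quarklet mt q)
  filter_upwards [h] with η hη
  exact ⟨fun q => ⟨_, hη q⟩, fun q n => rfl,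
    rescale_starHat_eq_gramSchmidt mt η (fun q => ⟨_, hη q⟩) fun q n => rfl⟩

theorem norm_gramSchmidt_le {E : Type*} [NormedAddCommGroup E] [InnerProductSpace ℂ E]
    (V : ℕ → E) (q : ℕ) : ‖InnerProductSpace.gramSchmidt ℂ V q‖ ≤ ‖V q‖ := by
  have h := InnerProductSpace.gramSchmidt_def'' ℂ V q
  set s := ∑ i ∈ Finset.Iio q, (inner ℂ (InnerProductSpace.gramSchmidt ℂ V i) (V q) /
    (‖InnerProductSpace.gramSchmidt ℂ V i‖ : ℂ) ^ 2) • InnerProductSpace.gramSchmidt ℂ V i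
  have h0 : inner ℂ (InnerProductSpace.gramSchmidt ℂ V q) s = 0 := by
    rw [inner_sum]
    refine Finset.sum_eq_zero fun i hi => ?_
    rw [inner_smul_right, InnerProductSpace.gramSchmidt_orthogonal ℂ V (Finset.mem_Iio.1 hi).ne',
      mul_zero]
  have := norm_add_sq_eq_norm_sq_add_norm_sq_of_inner_eq_zero _ _ h0
  have h' : V q = InnerProductSpace.gramSchmidt ℂ V q + s := h
  rw [← h'] at this
  nlinarith [norm_nonneg (V q), norm_nonneg (InnerProductSpace.gramSchmidt ℂ V q),
    mul_self_nonneg ‖s‖]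

theorem tsum_enorm_sq_eq (v : lp (fun _ : ℤ => ℂ) 2) :
    ∑' n : ℤ, ‖v n‖ₑ ^ (2 : ℝ) = ENNReal.ofReal (‖v‖ ^ (2 : ℝ)) := by
  have h := lp.norm_rpow_eq_tsum (p := 2) (by norm_num) v
  have hs := (lp.memℓp v).summable (p := 2) (by norm_num)
  simp only [ENNReal.toReal_ofNat] at h hs
  rw [h, ENNReal.ofReal_tsum_of_nonneg (fun n => by positivity) hs]
  refine tsum_congr fun n => ?_
  rw [← ENNReal.ofReal_rpow_of_nonneg (norm_nonneg _) zero_le_two, ofReal_norm]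

theorem measurable_rescale {g : ℝ → ℂ} (hg : Measurable g) : Measurable (rescale g) := by
  unfold rescale
  fun_prop

/-- The squared `L₂` norm is the integral over `(0, 1]` of the squared fibre norms, and Gram-Schmidt
does not increase these. -/
theorem memLp_rescale_starHat (mt q : ℕ) : MemLp (rescale (starHat mt q)) 2 volume := by
  have hm := measurable_rescale (measurable_starHat mt q)
  have hq := memLp_rescale_fourier_quarklet mt q
  refine ⟨hm.aestronglyMeasurable, ?_⟩
  rw [eLpNorm_lt_top_iff_lintegral_rpow_enorm_lt_top two_ne_zero ENNReal.ofNat_ne_top]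
  refine lt_of_le_of_lt ?_
    (lintegral_rpow_enorm_lt_top_of_eLpNorm_lt_top two_ne_zero ENNReal.ofNat_ne_top hq.2)
  rw [ENNReal.toReal_ofNat,
    lintegral_eq_lintegral_tsum (h := fun x => ‖rescale (starHat mt q) x‖ₑ ^ (2 : ℝ))
      (hm.enorm.pow_const _).aemeasurable,
    lintegral_eq_lintegral_tsum (h := fun x => ‖rescale (fourier (quarklet mt q)) x‖ₑ ^ (2 : ℝ))
      (hq.1.enorm.pow_const _)]
  refine lintegral_mono_ae ?_
  filter_upwards [exists_fiber mt] with η ⟨V, h1, h2⟩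
  simp_rw [h1, h2, tsum_enorm_sq_eq]
  gcongr
  exact norm_gramSchmidt_le V q

theorem memLp_starHat (mt q : ℕ) : MemLp (starHat mt q) 2 volume := by
  rw [eq_rescale (starHat mt q)]
  exact (memLp_comp_affine (by positivity) 0 (memLp_rescale_starHat mt q)).const_mul _

theorem fourierTransform_starQuarklet_ae_eq (mt q : ℕ) :
    (Lp.fourierTransformₗᵢ ℝ ℂ (starQuarklet mt q) : L2R) =ᵐ[volume] rescale (starHat mt q) := by
  rw [starQuarklet, invFourier, dif_pos (memLp_rescale_starHat mt q),
    LinearIsometryEquiv.apply_symm_apply]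
  exact MemLp.coeFn_toLp _

end StarHat

/-! ### The spaces `W^*` and `W^{**}` -/

section StarSpaces

theorem inner_dilTrans_starQuarklet (mt : ℕ) {q r : ℕ} (h : q ≠ r) (j k l : ℤ) :
    inner ℂ (dilTrans j k (starQuarklet mt q)) (dilTrans j l (starQuarklet mt r)) = 0 := by
  have h0 : ∀ k : ℤ, inner ℂ (dilTrans 0 k (starQuarklet mt q)) (starQuarklet mt r) = 0 := by
    refine (forall_inner_translate_eq_zero_iff _ _ (fourierTransform_starQuarklet_ae_eq mt q)
      (fourierTransform_starQuarklet_ae_eq mt r)).2 ?_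
    filter_upwards [exists_fiber mt] with η ⟨V, _, h2⟩
    simp_rw [h2]
    rw [← lp.inner_eq_tsum]
    exact InnerProductSpace.gramSchmidt_orthogonal ℂ V h
  rw [dilTrans_eq_comp j k, dilTrans_eq_comp j l, LinearIsometry.inner_map_map]
  -- A common translation can be removed by unitarity, so only the relative shift `k - l` matters.
  have hk : dilTrans 0 k (starQuarklet mt q) =
      dilTrans 0 l (dilTrans 0 (k - l) (starQuarklet mt q)) := by
    rw [dilTrans_dilTrans 0 0 l (k - l) le_rfl]
    simp
  rw [hk, LinearIsometry.inner_map_map]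
  exact h0 _

theorem isOrtho_spaceWStarStar (mt : ℕ) {q r : ℕ} (h : q ≠ r) (j : ℤ) :
    spaceWStarStar mt q j ⟂ spaceWStarStar mt r j := by
  rw [Submodule.isOrtho_iff_le]
  refine shiftSpace_le (F := starQuarklet mt) (fun _ _ => Filter.EventuallyEq.rfl)
    (Submodule.isClosed_orthogonal _) ?_
  rintro _ rfl k
  refine (mem_orthogonal_shiftSpace (F := starQuarklet mt)
    (fun _ _ => Filter.EventuallyEq.rfl)).2 ?_
  rintro _ rfl l
  exact inner_dilTrans_starQuarklet mt h.symm j l k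

/-- Both conditions are fibrewise orthogonality of the transform of `g` to the first `p + 1`
vectors, before and after Gram-Schmidt, and these have the same span. -/
theorem forall_inner_dilTrans_iff (mt p : ℕ) (g : L2R) :
    (∀ q ∈ Set.Iic p, ∀ k : ℤ, inner ℂ (dilTrans 0 k (starQuarklet mt q)) g = 0) ↔
      ∀ q ∈ Set.Iic p, ∀ k : ℤ, inner ℂ (dilTrans 0 k (quarkletLp mt q)) g = 0 := by
  have hS := fun q => forall_inner_translate_eq_zero_iff _ g
    (fourierTransform_starQuarklet_ae_eq mt q) Filter.EventuallyEq.rfl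
  have hQ := fun q => forall_inner_translate_eq_zero_iff _ g
    (fourierTransform_quarkletLp_ae_eq mt q) Filter.EventuallyEq.rfl
  simp_rw [hS, hQ, ← ae_ball_iff (Set.to_countable (Set.Iic p))]
  refine Filter.eventually_congr ?_
  filter_upwards [exists_fiber mt,
    ae_memℓp_fiber (Lp.memLp (Lp.fourierTransformₗᵢ ℝ ℂ g))] with η ⟨V, h1, h2⟩ hG
  have hin : ∀ v : lp (fun _ : ℤ => ℂ) 2, ∑' n : ℤ, inner ℂ (v n)
      ((Lp.fourierTransformₗᵢ ℝ ℂ g : L2R) (η + n)) =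
      inner ℂ v (⟨_, hG⟩ : lp (fun _ : ℤ => ℂ) 2) := fun v => rfl
  simp_rw [h1, h2, hin]
  set G : lp (fun _ : ℤ => ℂ) 2 := ⟨_, hG⟩
  have hspan : ∀ U : ℕ → lp (fun _ : ℤ => ℂ) 2, (∀ q ∈ Set.Iic p, inner ℂ (U q) G = 0) ↔
      G ∈ (Submodule.span ℂ (U '' Set.Iic p))ᗮ := by
    intro U
    rw [← Submodule.span_singleton_le_iff_mem, ← Submodule.isOrtho_iff_le, Submodule.isOrtho_comm,
      Submodule.isOrtho_span]
    simp
  rw [hspan, hspan, InnerProductSpace.span_gramSchmidt_Iic]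

/-- Closed subspaces are determined by their orthogonal complements; a dilation reduces the
comparison to `j = 0`. -/
theorem spaceWStar_eq_spaceW (mt p : ℕ) (j : ℤ) : spaceWStar mt p j = spaceW mt p j := by
  have h : (spaceWStar mt p j)ᗮ = (spaceW mt p j)ᗮ := by
    ext g
    obtain ⟨g, rfl⟩ := dilTrans_surjective j g
    rw [spaceWStar, spaceW, mem_orthogonal_shiftSpace (F := starQuarklet mt)
      (fun _ _ => Filter.EventuallyEq.rfl), mem_orthogonal_shiftSpace (F := quarkletLp mt)
      (fun q _ => coeFn_quarkletLp mt q)]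
    simp_rw [dilTrans_eq_comp j _ (starQuarklet mt _), dilTrans_eq_comp j _ (quarkletLp mt _),
      LinearIsometry.inner_map_map]
    exact forall_inner_dilTrans_iff mt p g
  have hS : (spaceWStar mt p j).topologicalClosure = spaceWStar mt p j :=
    (isClosed_shiftSpace _ _ _).submodule_topologicalClosure_eq
  have hQ : (spaceW mt p j).topologicalClosure = spaceW mt p j :=
    (isClosed_shiftSpace _ _ _).submodule_topologicalClosure_eq
  rw [← hS, ← hQ, ← Submodule.orthogonal_orthogonal_eq_closure, h,
    Submodule.orthogonal_orthogonal_eq_closure]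

/-- A finite sum of mutually orthogonal closed subspaces of a Hilbert space is closed. -/
theorem isClosed_iSup_of_pairwise_isOrtho {E ι : Type*} [NormedAddCommGroup E]
    [InnerProductSpace ℂ E] [CompleteSpace E] [Fintype ι] {K : ι → Submodule ℂ E}
    (hc : ∀ i, IsClosed (K i : Set E)) (ho : Pairwise fun i j => K i ⟂ K j) :
    IsClosed ((⨆ i, K i : Submodule ℂ E) : Set E) := by
  have (i : ι) : CompleteSpace (K i) := (hc i).completeSpace_coe
  -- By orthogonality `P` fixes every `K i`, and its values lie in their sum. The sum is therefore
  -- the fixed-point set of a continuous map.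
  let P : E →L[ℂ] E := ∑ i, (K i).starProjection
  have hP : ∀ x, P x = ∑ i, (K i).starProjection x := fun x => by simp [P]
  have hle : (⨆ i, K i : Submodule ℂ E) ≤ LinearMap.eqLocus (P : E →ₗ[ℂ] E) LinearMap.id := by
    refine iSup_le fun i x hx => ?_
    change P x = x
    rw [hP, Finset.sum_eq_single i]
    · exact Submodule.starProjection_eq_self_iff.2 hx
    · intro l _ hl
      exact (Submodule.starProjection_apply_eq_zero_iff _).2 ((ho hl.symm).le hx)
    · simp
  have heq : ((⨆ i, K i : Submodule ℂ E) : Set E) = {x | P x = x} := by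
    refine Set.Subset.antisymm hle fun x hx => ?_
    have hx' : P x = x := hx
    rw [← hx', hP]
    exact Submodule.sum_mem _ fun i _ =>
      Submodule.mem_iSup_of_mem i (Submodule.starProjection_apply_mem _ _)
  rw [heq]
  exact isClosed_eq P.continuous continuous_id

theorem spaceWStar_eq_iSup (mt p : ℕ) (j : ℤ) :
    spaceWStar mt p j = ⨆ q : Fin (p + 1), spaceWStarStar mt q j := by
  refine le_antisymm ?_ (iSup_le fun q => ?_)
  · refine shiftSpace_le (F := starQuarklet mt) (fun _ _ => Filter.EventuallyEq.rfl) ?_ ?_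
    · refine isClosed_iSup_of_pairwise_isOrtho (fun q => isClosed_shiftSpace _ _ _) ?_
      intro q r hqr
      exact isOrtho_spaceWStarStar mt (fun h => hqr (Fin.ext h)) j
    · intro q hq k
      refine Submodule.mem_iSup_of_mem ⟨q, Nat.lt_succ_of_le hq⟩ ?_
      exact dilTrans_mem_shiftSpace (F := starQuarklet mt) (fun _ _ => Filter.EventuallyEq.rfl) j
        (Set.mem_singleton q) k
  · refine shiftSpace_le (F := starQuarklet mt) (fun _ _ => Filter.EventuallyEq.rfl)
      (isClosed_shiftSpace _ _ _) ?_
    rintro _ rfl k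
    exact dilTrans_mem_shiftSpace (F := starQuarklet mt) (fun _ _ => Filter.EventuallyEq.rfl) j
      (Set.mem_Iic.2 (Nat.le_of_lt_succ q.isLt)) k

end StarSpaces

end Quarklet
-- Assembly of the theorem
theorem theorem6p14 (mt : ℕ) (hmt : Odd mt) (p : ℕ) :
    -- the orthogonalized quarklets are well-defined elements of `L₂(ℝ)`
    (∀ q ≤ p, MeasureTheory.MemLp (Quarklet.starHat mt q) 2 MeasureTheory.volume) ∧
    -- for each `j`, `W^*_{p,j}` is the orthogonal direct sum of the `W^{**}_{q,j}`, `q ≤ p`,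
    -- and it equals `W_{p,j}`
    (∀ j : ℤ,
      (∀ q ≤ p, ∀ r ≤ p, q ≠ r →
        Quarklet.spaceWStarStar mt q j ⟂ Quarklet.spaceWStarStar mt r j) ∧
      Quarklet.spaceWStar mt p j = (⨆ q : Fin (p + 1), Quarklet.spaceWStarStar mt q j) ∧
      Quarklet.spaceWStar mt p j = Quarklet.spaceW mt p j) ∧
    -- the decomposition over all `j ∈ ℤ`
    Quarklet.IsClosureOfDirectSum (fun j : ℤ => Quarklet.spaceWStar mt p j) ∧
    Quarklet.IsClosureOfDirectSum
      (fun j : ℤ => ⨆ q : Fin (p + 1), Quarklet.spaceWStarStar mt q j) ∧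
    -- the decomposition with `V_{p,0}` and `j ≥ 0`
    Quarklet.IsClosureOfDirectSum
      (Quarklet.consFamily (Quarklet.spaceV p 0)
        (fun j : ℕ => Quarklet.spaceWStar mt p (j : ℤ))) ∧
    Quarklet.IsClosureOfDirectSum
      (Quarklet.consFamily (Quarklet.spaceV p 0)
        (fun j : ℕ => ⨆ q : Fin (p + 1), Quarklet.spaceWStarStar mt q (j : ℤ))) := by
  have hW : ∀ j : ℤ, Quarklet.spaceWStar mt p j = Quarklet.spaceW mt p j :=
    Quarklet.spaceWStar_eq_spaceW mt p
  simp_rw [← Quarklet.spaceWStar_eq_iSup, hW]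
  have hZ : Quarklet.IsClosureOfDirectSum (fun j : ℤ => Quarklet.spaceW mt p j) :=
    ⟨Quarklet.iSupIndep_spaceW mt p, Quarklet.topologicalClosure_iSup_spaceW mt p⟩
  have hN : Quarklet.IsClosureOfDirectSum (Quarklet.consFamily (Quarklet.spaceV p 0)
      (fun j : ℕ => Quarklet.spaceW mt p (j : ℤ))) :=
    ⟨Quarklet.iSupIndep_consFamily mt p, Quarklet.topologicalClosure_iSup_consFamily mt p⟩
  exact ⟨fun q _ => Quarklet.memLp_starHat mt q,
    fun j => ⟨fun q _ r _ h => Quarklet.isOrtho_spaceWStarStar mt h j, trivial, trivial⟩, hZ, hZ, hN, hN⟩
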